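/- **Compressed Sommerfeld representation for the half-space impedance problem.** *Setting.* Let $k>0$, and let the impedance parameter $\alpha$ satisfy $\operatorname{Im}\alpha>0$, or $\alpha\in\mathbb R$ with $\alpha\ge 0$ or $\alpha<-k$. Let $g(\mathbf x,\mathbf x_0)=\frac i4H_0(k|\mathbf x-\mathbf x_0|)$, where $H_n=J_n+iY_n$ is the Hankel function of the first kind, and let $\mu(s)=2i\alpha e^{i\alpha s}$. Let sources $\mathbf x_j=(x_j,y_j)$, $j=1,\dots,N$, of real strengths $q_j$, a centre $\mathbf x_c=(x_c,y_c)$ and a target $\mathbf x=(x,y)$ lie in the open upper half-plane. Write $\mathbf x_0^{im}=(x_0,-y_0)$ and $\hat y=(0,1)$. The scattered field is $$u^s(\mathbf x)=\sum_{j=1}^N q_j\Big(g(\mathbf x,\mathbf x_j^{im})+\int_0^\infty g(\mathbf x,\mathbf x_j^{im}-s\hat y)\,\mu(s)\,ds\Big).$$ With $(\rho_j,\theta_j)$ the polar coordinates of $\mathbf x_j-\mathbf x_c$ and $\alpha_p=\sum_j q_je^{-ip\theta_j}J_p(k\rho_j)$, its truncated image expansion is $$u^s_P(\mathbf x)=\frac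 i4\sum_{p=-P}^P\bar\alpha_p\Big(H_p(k\rho(0))e^{ip\theta(0)}+\int_0^\infty H_p(k\rho(s))e^{ip\theta(s)}\mu(s)\,ds\Big),$$ where $(\rho(s),\theta(s))$ are the polar coordinates of $\mathbf x-(\mathbf x_c^{im}-s\hat y)$. Integrals in $s$ are improper: $\int_0^\infty=\lim_{S\to\infty}\int_0^S$. For real $\lambda$, $\sqrt{\lambda^2-k^2}$ is nonnegative if $|\lambda|\ge k$ and equals $-i\sqrt{k^2-\lambda^2}$ if $|\lambda|<k$. Put $z(\lambda)=(\lambda-\sqrt{\lambda^2-k^2})/k$ and $$A(\lambda)=\frac{e^{-\sqrt{\lambda^2-k^2}(y+y_c)}}{\sqrt{\lambda^2-k^2}}e^{i\lambda(x-x_c)},\qquad \hat\sigma(\lambda)=\frac{\sqrt{\lambda^2-k^2}+i\alpha}{\sqrt{\lambda^2-k^2}-i\alpha},$$ $$C_P(\lambda)=\frac1{4\pi}\sum_{p=-P}^P\bar\alpha_p(-i)^pz(\lambda)^p,\qquad U(\lambda)=\frac1{4\pi}\sum_{j=1}^Nq_je^{-\sqrt{\lambda^2-k^2}(y_j-y_c)}e^{i\lambda(x_c-x_j)}.$$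 *Claim.* 1. For all $n\in\mathbb Z$ and all points $(\xi,\eta)$ with $\eta>0$ and polar coordinates $(\rho,\theta)$, $$H_n(k\rho)e^{in\theta}=\frac{(-i)^n}{i\pi}\int_{-\infty}^\infty\frac{e^{-\sqrt{\lambda^2-k^2}\,\eta}}{\sqrt{\lambda^2-k^2}}e^{i\lambda \xi}z(\lambda)^n\,d\lambda,$$ with an absolutely integrable integrand. 2. (Compressed representation.) For every $p\in\mathbb Z$ the improper integral $\int_0^\infty H_p(k\rho(s))e^{ip\theta(s)}\mu(s)\,ds$ converges, and for every $P\ge0$ the function $A\,C_P\,\hat\sigma$ is integrable and $u^s_P(\mathbf x)=\int_{-\infty}^\infty A(\lambda)C_P(\lambda)\hat\sigma(\lambda)\,d\lambda$. 3. (Uncompressed representation.) The improper integrals defining $u^s(\mathbf x)$ converge, $A\,U\,\hat\sigma$ is integrable, and $u^s(\mathbf x)=\int_{-\infty}^\infty A(\lambda)U(\lambda)\hat\sigma(\lambda)\,d\lambda$. 4. There is a holomorphic function $F$ on $\mathbb C\setminus\{0\}$ such that $z(\lambda)\ne0$ and $U(\lambda)=F(z(\lambda))$ for every real $\lambda$,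 and whose Laurent expansion is $F(z)=\sum_{p\in\mathbb Z}\frac1{4\pi}\bar\alpha_p(-i)^pz^p$ for all $z\neq0$. The factor $C_P(\lambda)$ is the truncation of this expansion to $|p|\le P$ at $z=z(\lambda)$. 5. If $|\mathbf x_j-\mathbf x_c|<y+y_c$ for all $j$ (for instance, if the sources lie in a disc centred at $\mathbf x_c$ and contained in the upper half-plane), then $\int_{-\infty}^\infty A\,C_P\,\hat\sigma\,d\lambda\to u^s(\mathbf x)$ as $P\to\infty$. -/

import Mathlib

open Filter Topology MeasureTheory
open scoped ComplexConjugate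

namespace HalfSpace

noncomputable section

/-- Bessel function of the first kind of integer order, by its power series, with
`J_{-n} = (-1)^n J_n`. -/
def besselJ (n : ℤ) (x : ℝ) : ℝ :=
  (if 0 ≤ n then 1 else (-1) ^ n.natAbs) *
    ∑' m : ℕ, (-1) ^ m / ((m.factorial : ℝ) * ((m + n.natAbs).factorial : ℝ)) *
      (x / 2) ^ (2 * m + n.natAbs)

/-- Bessel function of the second kind (Neumann function) of integer order, for arguments `x > 0`,
by Schläfli's integral. -/
def besselY (n : ℤ) (x : ℝ) : ℝ :=
  (1 / Real.pi) * (∫ t in (0 : ℝ)..Real.pi, Real.sin (x * Real.sin t - n * t)) -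
    (1 / Real.pi) * ∫ t in Set.Ioi (0 : ℝ),
      (Real.exp (n * t) + (-1) ^ n * Real.exp (-(n * t))) * Real.exp (-(x * Real.sinh t))

/-- Hankel function of the first kind of integer order, for arguments `x > 0`. -/
def hankel1 (n : ℤ) (x : ℝ) : ℂ := (besselJ n x : ℂ) + Complex.I * (besselY n x : ℂ)

/-- `H_n(kρ) e^{inθ}`, where `(ρ, θ)` are the polar coordinates of the point `w = x + iy`. Points of
the plane are written as complex numbers throughout. -/
def hankelWave (k : ℝ) (n : ℤ) (w : ℂ) : ℂ :=
  hankel1 n (k * ‖w‖) * Complex.exp (Complex.I * n * (w.arg : ℂ))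

/-- The outgoing free-space Green's function of the Helmholtz equation. -/
def freeGreen (k : ℝ) (x x₀ : ℂ) : ℂ := Complex.I / 4 * hankel1 0 (k * ‖x - x₀‖)

/-- The density of the line image. -/
def lineImage (α : ℂ) (s : ℝ) : ℂ :=
  2 * Complex.I * α * Complex.exp (Complex.I * α * (s : ℂ))

/-- The mirror image `(x₀, -y₀)` of `(x₀, y₀)`, moved down by `s`. -/
def imagePoint (x₀ : ℂ) (s : ℝ) : ℂ := conj x₀ - (s : ℂ) * Complex.I

/-- The improper integral of `f` over `[0, ∞)` converges (perhaps only conditionally). -/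
def ImproperConverges (f : ℝ → ℂ) : Prop :=
  (∀ S : ℝ, 0 ≤ S → IntervalIntegrable f volume 0 S) ∧
    ∃ L : ℂ, Tendsto (fun S : ℝ => ∫ s in (0 : ℝ)..S, f s) atTop (𝓝 L)

/-- The improper integral of `f` over `[0, ∞)`, as a limit of integrals over `[0, S]`. -/
def improperIntegral (f : ℝ → ℂ) : ℂ := limUnder atTop (fun S : ℝ => ∫ s in (0 : ℝ)..S, f s)

/-- The field at `x` scattered by the impedance half-space, for a unit source at `x₀`. -/
def scattered (k : ℝ) (α x x₀ : ℂ) : ℂ :=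
  freeGreen k x (imagePoint x₀ 0) +
    improperIntegral fun s => freeGreen k x (imagePoint x₀ s) * lineImage α s

/-- The field at `x` scattered by the impedance half-space, for sources `X j` of strength `q j`. -/
def scatteredField {N : ℕ} (k : ℝ) (α : ℂ) (q : Fin N → ℝ) (X : Fin N → ℂ) (x : ℂ) : ℂ :=
  ∑ j, (q j : ℂ) * scattered k α x (X j)

/-- The free-space multipole coefficients about the centre `c`. -/
def multipoleCoeff {N : ℕ} (k : ℝ) (q : Fin N → ℝ) (X : Fin N → ℂ) (c : ℂ) (p : ℤ) : ℂ :=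
  ∑ j, (q j : ℂ) * Complex.exp (-(Complex.I * p * ((X j - c).arg : ℂ))) *
    (besselJ p (k * ‖X j - c‖) : ℂ)

/-- The image expansion of the scattered field, truncated at `|p| ≤ P`. -/
def imageExpansion {N : ℕ} (k : ℝ) (α : ℂ) (q : Fin N → ℝ) (X : Fin N → ℂ) (c : ℂ) (P : ℕ)
    (x : ℂ) : ℂ :=
  Complex.I / 4 * ∑ p ∈ Finset.Icc (-(P : ℤ)) P, conj (multipoleCoeff k q X c p) *
    (hankelWave k p (x - imagePoint c 0) +
      improperIntegral fun s => hankelWave k p (x - imagePoint c s) * lineImage α s)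

/-- `√(l² - k²)` on the branch given by the radiation condition: it is nonnegative for `|l| ≥ k`
and equal to `-i √(k² - l²)` for `|l| < k` (`Real.sqrt` vanishes on negative numbers). -/
def spectralRoot (k l : ℝ) : ℂ :=
  (Real.sqrt (l ^ 2 - k ^ 2) : ℂ) - Complex.I * (Real.sqrt (k ^ 2 - l ^ 2) : ℂ)

/-- The spectral variable `z = (l - √(l² - k²)) / k`. -/
def spectralZ (k l : ℝ) : ℂ := ((l : ℂ) - spectralRoot k l) / (k : ℂ)

/-- The free-space factor `e^{-√(l² - k²) y} e^{ilx} / √(l² - k²)` at the point `w = x + iy`. -/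
def freeSpaceInfo (k : ℝ) (w : ℂ) (l : ℝ) : ℂ :=
  Complex.exp (-(spectralRoot k l * (w.im : ℂ))) / spectralRoot k l *
    Complex.exp (Complex.I * (l : ℂ) * (w.re : ℂ))

/-- The reflection factor. -/
def imageInfo (k : ℝ) (α : ℂ) (l : ℝ) : ℂ :=
  (spectralRoot k l + Complex.I * α) / (spectralRoot k l - Complex.I * α)

/-- The compressed source factor. -/
def compressed {N : ℕ} (k : ℝ) (q : Fin N → ℝ) (X : Fin N → ℂ) (c : ℂ) (P : ℕ) (l : ℝ) : ℂ :=
  1 / (4 * (Real.pi : ℂ)) * ∑ p ∈ Finset.Icc (-(P : ℤ)) P,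
    conj (multipoleCoeff k q X c p) * (-Complex.I) ^ p * spectralZ k l ^ p

/-- The uncompressed source factor. -/
def uncompressed {N : ℕ} (k : ℝ) (q : Fin N → ℝ) (X : Fin N → ℂ) (c : ℂ) (l : ℝ) : ℂ :=
  1 / (4 * (Real.pi : ℂ)) * ∑ j, (q j : ℂ) *
    Complex.exp (-(spectralRoot k l * (((X j).im - c.im : ℝ) : ℂ))) *
    Complex.exp (Complex.I * (l : ℂ) * ((c.re - (X j).re : ℝ) : ℂ))

end

end HalfSpace

/-! Everything reduces to one spectral integral. Put `l = k cosh ζ` and `√(l² - k²) = -k sinh ζ`, so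
that `z = e^ζ`. The real `l`-axis, run from `∞` to `-∞`, becomes the broken line from `-∞` through
`0` and `iπ` to `∞ + iπ`. The root in the denominator cancels against the Jacobian, and the
integrand becomes `exp(kρ sinh(ζ + i(π/2 - θ)) + nζ)` up to a constant phase. For `0 < θ < π` this
contour can be moved vertically to height `0`, where it gives Schläfli's integral for `H_n`: this is
`hankelWave_eq_integral`.

Lowering an image by `s` multiplies its spectrum by `e^{-√(l² - k²) s}`. Integration against the
line density over `[0, S]` gives the factor `2iα / (√(l² - k²) - iα)` times `1 - e^{iαS} e^{-√(l² -
k²) S}`. The boundary term disappears as `S → ∞` by a Riemann-Lebesgue argument, and adding the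
point image `1` gives the reflection factor. `improperIntegral_lineImage` thus yields both spectral
representations.

On the source side, the generating function `e^{(x/2)(t - 1/t)} = ∑ J_p(x) t^p` is evaluated at `x =
kρ_j`, `t = -i z e^{iθ_j}`. The left side is then exactly the exponential of the `j`-th source, so
the sum over the sources is holomorphic in `z ≠ 0` and the multipole coefficients are its Laurent
coefficients. All finite partial sums are bounded by `exp((kρ_j/2)(|z| + 1/|z|)) ≤ exp(ρ_j (k + Re
√(l² - k²)))`. If `ρ_j < y + y_c`, the decay of `A` beats this growth, and dominated convergence
gives the limit `P → ∞`. -/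

namespace HalfSpace

/-! ### Bessel functions: generating function and Bessel's integral -/

/-- Pairs of exponents `(a, b)` in a product of two power series, sorted by `a - b`. -/
def diffEquiv : ℤ × ℕ ≃ ℕ × ℕ where
  toFun pm := (pm.2 + pm.1.toNat, pm.2 + (-pm.1).toNat)
  invFun ab := ((ab.1 : ℤ) - ab.2, min ab.1 ab.2)
  left_inv := by
    rintro ⟨p, m⟩
    ext
    · simp; try omega
    · simp; omega
  right_inv := by
    rintro ⟨a, b⟩
    ext <;> simp <;> omega

/-- The product of the exponential series of `u` and `v`, before summation. -/
noncomputable def expProdTerm (u v : ℂ) (ab : ℕ × ℕ) : ℂ :=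
  u ^ ab.1 / (ab.1.factorial : ℂ) * (v ^ ab.2 / (ab.2.factorial : ℂ))

theorem norm_expProdTerm (u v : ℂ) (ab : ℕ × ℕ) :
    ‖expProdTerm u v ab‖ =
      ‖u‖ ^ ab.1 / (ab.1.factorial : ℝ) * (‖v‖ ^ ab.2 / (ab.2.factorial : ℝ)) := by
  simp [expProdTerm]

theorem hasSum_norm_expProdTerm (u v : ℂ) :
    HasSum (fun ab => ‖expProdTerm u v ab‖) (Real.exp (‖u‖ + ‖v‖)) := by
  have h (r : ℝ) : HasSum (fun n : ℕ => r ^ n / (n.factorial : ℝ)) (Real.exp r) := by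
    rw [Real.exp_eq_exp_ℝ]; exact NormedSpace.expSeries_div_hasSum_exp r
  have hs : Summable fun ab : ℕ × ℕ =>
      ‖u‖ ^ ab.1 / (ab.1.factorial : ℝ) * (‖v‖ ^ ab.2 / (ab.2.factorial : ℝ)) :=
    (h ‖u‖).summable.mul_of_nonneg (h ‖v‖).summable
      (fun _ => by positivity) (fun _ => by positivity)
  simp_rw [norm_expProdTerm, Real.exp_add]
  exact (h ‖u‖).mul (h ‖v‖) hs

theorem hasSum_pow_div_factorial (r : ℂ) :
    HasSum (fun n : ℕ => r ^ n / (n.factorial : ℂ)) (Complex.exp r) := by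
  rw [Complex.exp_eq_exp_ℂ]
  exact NormedSpace.expSeries_div_hasSum_exp r

theorem hasSum_expProdTerm (u v : ℂ) :
    HasSum (expProdTerm u v) (Complex.exp (u + v)) := by
  have hs : Summable (expProdTerm u v) := (hasSum_norm_expProdTerm u v).summable.of_norm
  have hn (r : ℂ) : Summable fun n : ℕ => ‖r ^ n / (n.factorial : ℂ)‖ :=
    (hasSum_pow_div_factorial r).summable.norm
  have h := tsum_mul_tsum_of_summable_norm (hn u) (hn v)
  rw [(hasSum_pow_div_factorial u).tsum_eq, (hasSum_pow_div_factorial v).tsum_eq,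
    ← Complex.exp_add] at h
  rw [h]
  exact hs.hasSum

theorem hasSum_fiber_expProdTerm (u v : ℂ) :
    HasSum (fun p : ℤ => ∑' m : ℕ, expProdTerm u v (diffEquiv (p, m))) (Complex.exp (u + v)) := by
  have h : HasSum (expProdTerm u v ∘ diffEquiv) (Complex.exp (u + v)) :=
    diffEquiv.hasSum_iff.mpr (hasSum_expProdTerm u v)
  exact h.prod_fiberwise fun p => (h.summable.prod_factor p).hasSum

/-- The bound does not depend on the finite set; this is where the majorant uniform in `P`
originates. -/
theorem sum_norm_fiber_expProdTerm_le (u v : ℂ) (s : Finset ℤ) :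
    ∑ p ∈ s, ‖∑' m : ℕ, expProdTerm u v (diffEquiv (p, m))‖ ≤ Real.exp (‖u‖ + ‖v‖) := by
  have h : HasSum ((fun ab => ‖expProdTerm u v ab‖) ∘ diffEquiv) (Real.exp (‖u‖ + ‖v‖)) :=
    diffEquiv.hasSum_iff.mpr (hasSum_norm_expProdTerm u v)
  have h2 := h.prod_fiberwise fun p => (h.summable.prod_factor p).hasSum
  refine le_trans (Finset.sum_le_sum fun p _ => ?_)
    (sum_le_hasSum s (fun p _ => tsum_nonneg fun m => norm_nonneg _) h2)
  exact norm_tsum_le_tsum_norm (h.summable.prod_factor p)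

/-- With `u = xt/2` and `v = -x/(2t)`, the product `u^a v^b` carries the power `t^(a - b)`, so the
fibre `a - b = p` of the double series for `e^u e^v` collects exactly the power series of `J_p`. For
`p < 0` the extra `|p|` factors `v` produce the sign in the definition of `besselJ`. -/
theorem besselJ_mul_zpow (p : ℤ) (x : ℝ) {t : ℂ} (ht : t ≠ 0) :
    (besselJ p x : ℂ) * t ^ p =
      ∑' m : ℕ, expProdTerm (x / 2 * t) (-(x / 2 * t⁻¹)) (diffEquiv (p, m)) := by
  rw [besselJ]
  push_cast
  rw [← tsum_mul_left, ← tsum_mul_right]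
  refine tsum_congr fun m => ?_
  rcases le_or_gt 0 p with hp | hp
  · obtain ⟨n, rfl⟩ := Int.eq_ofNat_of_zero_le hp
    have h1 : (-(n : ℤ)).toNat = 0 := by omega
    simp only [expProdTerm, diffEquiv, Equiv.coe_fn_mk, h1, Int.toNat_natCast, add_zero,
      Int.natAbs_natCast, zpow_natCast, if_pos hp]
    have h2 : (t⁻¹) ^ m * t ^ (m + n) = t ^ n := by
      rw [pow_add, ← mul_assoc, ← mul_pow, inv_mul_cancel₀ ht, one_pow, one_mul]
    rw [← h2, neg_pow (x / 2 * t⁻¹ : ℂ), mul_pow, mul_pow]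
    push_cast
    ring
  · obtain ⟨n, rfl⟩ : ∃ n : ℕ, p = -(n : ℤ) := ⟨(-p).toNat, by omega⟩
    have h1 : (-(n : ℤ)).toNat = 0 := by omega
    simp only [expProdTerm, diffEquiv, Equiv.coe_fn_mk, h1, neg_neg, Int.toNat_natCast, add_zero,
      Int.natAbs_neg, Int.natAbs_natCast, zpow_neg, zpow_natCast, if_neg (not_le.mpr hp)]
    have h2 : t ^ m * (t⁻¹) ^ (m + n) = (t ^ n)⁻¹ := by
      rw [pow_add, ← mul_assoc, ← mul_pow, mul_inv_cancel₀ ht, one_pow, one_mul, inv_pow]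
    rw [← h2, neg_pow (x / 2 * t⁻¹ : ℂ), mul_pow, mul_pow]
    push_cast
    ring

/-- The generating function of the Bessel functions of integer order. -/
theorem hasSum_besselJ_mul_zpow (x : ℝ) {t : ℂ} (ht : t ≠ 0) :
    HasSum (fun p : ℤ => (besselJ p x : ℂ) * t ^ p) (Complex.exp (x / 2 * (t - t⁻¹))) := by
  simp_rw [besselJ_mul_zpow _ x ht]
  convert hasSum_fiber_expProdTerm (x / 2 * t) (-(x / 2 * t⁻¹)) using 2
  ring

theorem sum_norm_besselJ_mul_zpow_le (x : ℝ) {t : ℂ} (ht : t ≠ 0) (s : Finset ℤ) :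
    ∑ p ∈ s, ‖(besselJ p x : ℂ) * t ^ p‖ ≤ Real.exp (|x| / 2 * (‖t‖ + ‖t‖⁻¹)) := by
  simp_rw [besselJ_mul_zpow _ x ht]
  convert sum_norm_fiber_expProdTerm_le (x / 2 * t) (-(x / 2 * t⁻¹)) s using 2
  simp
  ring

theorem summable_norm_besselJ (x : ℝ) : Summable fun p : ℤ => ‖(besselJ p x : ℂ)‖ := by
  refine summable_of_sum_le (c := Real.exp (|x| / 2 * (1 + 1))) (fun p => norm_nonneg _) fun s => ?_
  simpa using sum_norm_besselJ_mul_zpow_le x one_ne_zero s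

theorem integral_exp_int_mul (m : ℤ) :
    ∫ t in (-Real.pi)..Real.pi, Complex.exp (Complex.I * m * t) =
      if m = 0 then 2 * (Real.pi : ℂ) else 0 := by
  split_ifs with h
  · subst h
    simp
    ring
  · rw [integral_exp_mul_complex (by simpa using h)]
    have h1 : Complex.exp (Complex.I * m * (Real.pi : ℂ)) =
        Complex.exp (Complex.I * m * ((-Real.pi : ℝ) : ℂ)) := by
      rw [Complex.exp_eq_exp_iff_exists_int]
      refine ⟨m, ?_⟩
      push_cast
      ring
    rw [h1, sub_self, zero_div]

/-- Bessel's integral over a full period. -/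
theorem two_pi_mul_besselJ (n : ℤ) (x : ℝ) :
    ∫ t in (-Real.pi)..Real.pi, Complex.exp (Complex.I * (x * Real.sin t - n * t : ℝ)) =
      2 * Real.pi * (besselJ n x : ℂ) := by
  have hexp (t : ℝ) : HasSum
      (fun p : ℤ => (besselJ p x : ℂ) * Complex.exp (Complex.I * ((p - n : ℤ) : ℂ) * t))
      (Complex.exp (Complex.I * (x * Real.sin t - n * t : ℝ))) := by
    have h := (hasSum_besselJ_mul_zpow x (Complex.exp_ne_zero (Complex.I * t))).mul_right
      (Complex.exp (-(Complex.I * n * t)))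
    have hval : Complex.exp (Complex.I * (x * Real.sin t - n * t : ℝ)) =
        Complex.exp (x / 2 * (Complex.exp (Complex.I * t) - (Complex.exp (Complex.I * t))⁻¹)) *
          Complex.exp (-(Complex.I * n * t)) := by
      rw [← Complex.exp_add, ← Complex.exp_neg]
      congr 1
      push_cast
      rw [Complex.sin, mul_comm Complex.I (t : ℂ), neg_mul]
      linear_combination
        (x / 2 * (Complex.exp (-(t * Complex.I)) - Complex.exp (t * Complex.I))) * Complex.I_mul_I
    rw [hval]
    refine h.congr_fun fun p => ?_
    rw [← Complex.exp_int_mul, mul_assoc (besselJ p x : ℂ), ← Complex.exp_add]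
    congr 2
    push_cast
    ring
  have hint := intervalIntegral.hasSum_integral_of_dominated_convergence
    (μ := volume) (a := -Real.pi) (b := Real.pi)
    (F := fun (p : ℤ) (t : ℝ) =>
      (besselJ p x : ℂ) * Complex.exp (Complex.I * ((p - n : ℤ) : ℂ) * t))
    (fun p _ => ‖(besselJ p x : ℂ)‖)
    (fun p => (by fun_prop : Continuous _).aestronglyMeasurable)
    (fun p => Eventually.of_forall fun t _ => by
      rw [norm_mul, show Complex.I * ((p - n : ℤ) : ℂ) * t = (((p - n : ℤ) * t : ℝ) : ℂ) * Complex.I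
        by push_cast; ring, Complex.norm_exp_ofReal_mul_I, mul_one])
    (Eventually.of_forall fun t _ => summable_norm_besselJ x)
    (by simp) (Eventually.of_forall fun t _ => hexp t)
  -- Orthogonality of the exponentials over a period: only the term `p = n` survives.
  refine hint.unique ?_
  refine (hasSum_ite_eq n (2 * (Real.pi : ℂ) * (besselJ n x : ℂ))).congr_fun fun p => ?_
  rw [intervalIntegral.integral_const_mul, integral_exp_int_mul]
  by_cases h : p = n
  · subst h; simp; ring
  · simp [h, sub_eq_zero]

/-- Bessel's integral. -/
theorem pi_mul_besselJ (n : ℤ) (x : ℝ) :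
    ∫ t in (0 : ℝ)..Real.pi, Real.cos (x * Real.sin t - n * t) = Real.pi * besselJ n x := by
  have h := two_pi_mul_besselJ n x
  have hc : Continuous fun t : ℝ => Complex.exp (Complex.I * (x * Real.sin t - n * t : ℝ)) := by
    fun_prop
  rw [← intervalIntegral.integral_add_adjacent_intervals (hc.intervalIntegrable (-Real.pi) 0)
    (hc.intervalIntegrable 0 Real.pi)] at h
  have h2 := intervalIntegral.integral_comp_neg (a := 0) (b := Real.pi)
    fun t : ℝ => Complex.exp (Complex.I * (x * Real.sin t - n * t : ℝ))
  rw [neg_zero] at h2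
  rw [← h2, ← intervalIntegral.integral_add
    (Continuous.intervalIntegrable (by fun_prop) 0 Real.pi) (hc.intervalIntegrable 0 Real.pi)] at h
  have h3 : ∀ t : ℝ, Complex.exp (Complex.I * (x * Real.sin (-t) - n * (-t : ℝ) : ℝ)) +
      Complex.exp (Complex.I * (x * Real.sin t - n * t : ℝ)) =
      ((2 * Real.cos (x * Real.sin t - n * t) : ℝ) : ℂ) := by
    intro t
    rw [show x * Real.sin (-t) - n * (-t : ℝ) = -(x * Real.sin t - n * t) by
      rw [Real.sin_neg]; ring]
    generalize x * Real.sin t - n * t = a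
    push_cast
    rw [Complex.cos, mul_comm, mul_comm Complex.I]
    ring
  simp_rw [h3] at h
  rw [intervalIntegral.integral_ofReal, intervalIntegral.integral_const_mul] at h
  have h4 : 2 * ∫ t in (0 : ℝ)..Real.pi, Real.cos (x * Real.sin t - n * t) =
      2 * Real.pi * besselJ n x := by exact_mod_cast h
  linarith

/-! ### Contour integrals for the Hankel functions -/

/-- The integrand of the contour integrals for Hankel functions. -/
noncomputable def contourKernel (x : ℝ) (n : ℤ) (t : ℂ) : ℂ :=
  Complex.exp (x * Complex.sinh t + n * t)

theorem hasDerivAt_contourKernel (x : ℝ) (n : ℤ) (t : ℂ) :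
    HasDerivAt (contourKernel x n) ((x * Complex.cosh t + n) * contourKernel x n t) t := by
  have h : HasDerivAt (fun t : ℂ => x * Complex.sinh t + n * t) (x * Complex.cosh t + n * 1) t :=
    ((Complex.hasDerivAt_sinh t).const_mul _).add ((hasDerivAt_id t).const_mul _)
  refine h.cexp.congr_deriv ?_
  rw [contourKernel]
  ring

theorem continuous_contourKernel (x : ℝ) (n : ℤ) : Continuous (contourKernel x n) := by
  unfold contourKernel
  fun_prop

/-- The decay along a horizontal half-line is governed by `x cos y`, which confines all contours to
`|y| < π/2`. -/
theorem norm_contourKernel (x : ℝ) (n : ℤ) (s y : ℝ) :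
    ‖contourKernel x n (-s + Complex.I * y)‖ =
      Real.exp (-(x * Real.cos y) * Real.sinh s + (-n) * s) := by
  rw [contourKernel, Complex.norm_exp]
  congr 1
  rw [Complex.sinh_add, mul_comm Complex.I, Complex.cosh_mul_I, Complex.sinh_mul_I,
    ← Complex.ofReal_neg, ← Complex.ofReal_sinh, ← Complex.ofReal_cosh, ← Complex.ofReal_cos,
    ← Complex.ofReal_sin, Real.sinh_neg]
  simp [-Complex.ofReal_sinh, -Complex.ofReal_cosh, -Complex.ofReal_cos, -Complex.ofReal_sin,
    ← Complex.ofReal_intCast]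
  ring

/-- From `sinh s ≥ s²/4`; the constant comes from completing the square in `c s²/4 - (M + 1) s`. -/
theorem exp_neg_sinh_add_le {c : ℝ} (hc : 0 < c) (M : ℝ) {s : ℝ} (hs : 0 ≤ s) :
    Real.exp (-c * Real.sinh s + M * s) ≤ Real.exp ((M + 1) ^ 2 / c) * Real.exp (-s) := by
  rw [← Real.exp_add]
  apply Real.exp_le_exp.mpr
  have h1 : s ^ 2 / 4 ≤ Real.sinh s := by
    rw [Real.sinh_eq]
    have := Real.quadratic_le_exp_of_nonneg hs
    have := Real.exp_le_one_iff.mpr (neg_nonpos.mpr hs)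
    linarith
  have h2 : c * (s ^ 2 / 4) ≤ c * Real.sinh s := by gcongr
  have h3 : 0 ≤ (c * s / 2 - (M + 1)) ^ 2 / c := by positivity
  have h4 : (c * s / 2 - (M + 1)) ^ 2 / c = c * (s ^ 2 / 4) - (M + 1) * s + (M + 1) ^ 2 / c := by
    field_simp
    ring
  linarith

theorem integrableOn_const_mul_exp_neg (C : ℝ) :
    IntegrableOn (fun s : ℝ => C * Real.exp (-s)) (Set.Ioi 0) :=
  (integrableOn_exp_neg_Ioi 0).const_mul C

theorem integrableOn_contourKernel {x : ℝ} (n : ℤ) {y : ℝ} (hc : 0 < x * Real.cos y) :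
    IntegrableOn (fun s : ℝ => contourKernel x n (-s + Complex.I * y)) (Set.Ioi 0) := by
  refine Integrable.mono'
    (integrableOn_const_mul_exp_neg (Real.exp ((-n + 1) ^ 2 / (x * Real.cos y))))
    ((continuous_contourKernel x n).comp (by fun_prop)).aestronglyMeasurable
    ((ae_restrict_iff' measurableSet_Ioi).mpr (Eventually.of_forall fun s hs => ?_))
  rw [norm_contourKernel]
  exact exp_neg_sinh_add_le hc _ (le_of_lt hs)

/-- The growth `e^s` of `cosh` only raises the linear coefficient from `-n` to `-n + 1`. The bound
is uniform over all `y` with `x cos y ≥ c`, as differentiation under the integral requires. -/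
theorem norm_deriv_contourKernel_le {x c : ℝ} (hx : 0 < x) (hc : 0 < c) (n : ℤ) {s y : ℝ}
    (hs : 0 ≤ s) (hy : c ≤ x * Real.cos y) :
    ‖(x * Complex.cosh (-s + Complex.I * y) + n) * contourKernel x n (-s + Complex.I * y)‖ ≤
      (x + |(n : ℝ)|) * Real.exp ((-n + 1 + 1) ^ 2 / c) * Real.exp (-s) := by
  have hcosh : ‖Complex.cosh (-s + Complex.I * y)‖ ≤ Real.exp s := by
    rw [Complex.cosh, norm_div, div_le_iff₀ (by simp)]
    refine (norm_add_le _ _).trans ?_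
    rw [Complex.norm_exp, Complex.norm_exp]
    have : Real.exp (-s) ≤ Real.exp s := Real.exp_le_exp.mpr (by linarith)
    simp
    linarith
  have h1 : ‖(x * Complex.cosh (-s + Complex.I * y) + n)‖ ≤ (x + |(n : ℝ)|) * Real.exp s := by
    refine (norm_add_le _ _).trans ?_
    rw [norm_mul, Complex.norm_real, Real.norm_of_nonneg hx.le, add_mul, Complex.norm_intCast]
    have : |(n : ℝ)| * 1 ≤ |(n : ℝ)| * Real.exp s := by
      gcongr
      exact Real.one_le_exp hs
    have : x * ‖Complex.cosh (-s + Complex.I * y)‖ ≤ x * Real.exp s := by gcongr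
    linarith
  rw [norm_mul, norm_contourKernel]
  calc _ ≤ (x + |(n : ℝ)|) * Real.exp s *
        Real.exp (-c * Real.sinh s + (-n) * s) := by
        have := Real.sinh_nonneg_iff.mpr hs
        gcongr
    _ = (x + |(n : ℝ)|) * Real.exp (-c * Real.sinh s + (-n + 1) * s) := by
        rw [mul_assoc, ← Real.exp_add]
        ring_nf
    _ ≤ (x + |(n : ℝ)|) * (Real.exp ((-n + 1 + 1) ^ 2 / c) * Real.exp (-s)) := by
        gcongr
        exact exp_neg_sinh_add_le hc _ hs
    _ = _ := by ring

/-- The contour integral along the half-line from `-∞ + iy` to `iy`. -/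
noncomputable def halfLineIntegral (x : ℝ) (n : ℤ) (y : ℝ) : ℂ :=
  ∫ s in Set.Ioi (0 : ℝ), contourKernel x n (-s + Complex.I * y)

theorem hasDerivAt_halfLineIntegral {x : ℝ} (hx : 0 < x) (n : ℤ) {y : ℝ}
    (hy : |y| < Real.pi / 2) :
    HasDerivAt (halfLineIntegral x n) (Complex.I * contourKernel x n (Complex.I * y)) y := by
  obtain ⟨b, hyb, hb⟩ := exists_between hy
  have hb0 : 0 ≤ b := (abs_nonneg y).trans hyb.le
  have hcb : 0 < x * Real.cos b := mul_pos hx (Real.cos_pos_of_mem_Ioo ⟨by linarith, hb⟩)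
  have hcos : ∀ z : ℝ, |z| < b → x * Real.cos b ≤ x * Real.cos z := fun z hz => by
    rw [← Real.cos_abs z]
    gcongr
    exact Real.cos_le_cos_of_nonneg_of_le_pi (abs_nonneg z) (by linarith [Real.pi_pos]) hz.le
  have hline (z s : ℝ) : HasDerivAt (fun z : ℝ => contourKernel x n (-s + Complex.I * z))
      (Complex.I * ((x * Complex.cosh (-s + Complex.I * z) + n) *
        contourKernel x n (-s + Complex.I * z))) z := by
    have h1 := HasDerivAt.comp (h₂ := contourKernel x n) (z : ℂ)
      (hasDerivAt_contourKernel x n (-s + Complex.I * z))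
      (((hasDerivAt_id' (z : ℂ)).const_mul Complex.I).const_add (-s : ℂ))
    refine h1.comp_ofReal.congr_deriv ?_
    ring
  -- By holomorphy, the derivative in the height `z` is also an exact derivative in `s`; its
  -- integral reduces to the boundary value at `s = 0`.
  have hline' (z s : ℝ) : HasDerivAt
      (fun s : ℝ => -Complex.I * contourKernel x n (-s + Complex.I * z))
      (Complex.I * ((x * Complex.cosh (-s + Complex.I * z) + n) *
        contourKernel x n (-s + Complex.I * z))) s := by
    have h1 := HasDerivAt.comp (h₂ := contourKernel x n) (s : ℂ)
      (hasDerivAt_contourKernel x n (-s + Complex.I * z))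
      ((hasDerivAt_id' (s : ℂ)).fun_neg.add_const (Complex.I * z))
    refine ((h1.comp_ofReal).const_mul (-Complex.I)).congr_deriv ?_
    ring
  have hcont : Continuous fun s : ℝ => Complex.I *
      ((x * Complex.cosh (-s + Complex.I * y) + n) * contourKernel x n (-s + Complex.I * y)) := by
    have := continuous_contourKernel x n
    fun_prop
  have key := hasDerivAt_integral_of_dominated_loc_of_deriv_le
    (μ := volume.restrict (Set.Ioi (0 : ℝ))) (x₀ := y) (s := Set.Ioo (-b) b)
    (F := fun (z s : ℝ) => contourKernel x n (-s + Complex.I * z))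
    (F' := fun (z s : ℝ) => Complex.I * ((x * Complex.cosh (-s + Complex.I * z) + n) *
        contourKernel x n (-s + Complex.I * z)))
    (Ioo_mem_nhds (abs_lt.mp hyb).1 (abs_lt.mp hyb).2)
    (Eventually.of_forall fun z =>
      ((continuous_contourKernel x n).comp (by fun_prop)).aestronglyMeasurable)
    (integrableOn_contourKernel n (hcb.trans_le (hcos y hyb)))
    hcont.aestronglyMeasurable
    ((ae_restrict_iff' measurableSet_Ioi).mpr (Eventually.of_forall fun s hs z hz => by
      rw [norm_mul, Complex.norm_I, one_mul]
      exact norm_deriv_contourKernel_le hx hcb n (le_of_lt hs) (hcos z (abs_lt.mpr hz))))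
    (integrableOn_const_mul_exp_neg _)
    (Eventually.of_forall fun s z _ => hline z s)
  refine key.2.congr_deriv ?_
  have hlim : Tendsto (fun s : ℝ => -Complex.I * contourKernel x n (-s + Complex.I * y)) atTop
      (𝓝 0) := by
    rw [← mul_zero (-Complex.I)]
    refine Tendsto.const_mul _ (squeeze_zero_norm'
      (a := fun s => Real.exp ((-n + 1) ^ 2 / (x * Real.cos y)) * Real.exp (-s)) ?_ ?_)
    · filter_upwards [eventually_ge_atTop 0] with s hs
      rw [norm_contourKernel]
      exact exp_neg_sinh_add_le (hcb.trans_le (hcos y hyb)) _ hs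
    · simpa using Real.tendsto_exp_neg_atTop_nhds_zero.const_mul
        (Real.exp ((-n + 1) ^ 2 / (x * Real.cos y)))
  rw [integral_Ioi_of_hasDerivAt_of_tendsto' (fun s _ => hline' y s) key.1 hlim]
  simp

/-- Turns the right half-line at height `y + π` into a left half-line at height `-y` with order
`-n`, so one kind of half-line integral suffices. -/
theorem contourKernel_add_pi (x : ℝ) (n : ℤ) (t : ℂ) :
    contourKernel x n (t + Real.pi * Complex.I) = (-1) ^ n * contourKernel x (-n) (-t) := by
  rw [contourKernel, contourKernel, ← Complex.exp_pi_mul_I, ← Complex.exp_int_mul,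
    ← Complex.exp_add, Complex.sinh_add, Complex.sinh_mul_I, Complex.cosh_mul_I, Complex.sin_pi,
    Complex.cos_pi, Complex.sinh_neg]
  congr 1
  push_cast
  ring

/-- The contour integral from `-∞ + iy` to `∞ + i(y + π)`. -/
noncomputable def contourIntegral (x : ℝ) (n : ℤ) (y : ℝ) : ℂ :=
  halfLineIntegral x n y +
    Complex.I * (∫ u in y..(y + Real.pi), contourKernel x n (Complex.I * u)) +
    (-1) ^ n * halfLineIntegral x (-n) (-y)

/-- The endpoint contributions of the two half-lines cancel those of the vertical segment. This
plays the role of Cauchy's theorem in moving the contour. -/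
theorem hasDerivAt_contourIntegral {x : ℝ} (hx : 0 < x) (n : ℤ) {y : ℝ}
    (hy : |y| < Real.pi / 2) : HasDerivAt (contourIntegral x n) 0 y := by
  have hc : Continuous fun u : ℝ => contourKernel x n (Complex.I * u) :=
    (continuous_contourKernel x n).comp (by fun_prop)
  have h1 := hasDerivAt_halfLineIntegral hx n hy
  have h3 := (hasDerivAt_halfLineIntegral hx (-n) (y := -y) (by rwa [abs_neg])).scomp y
    (hasDerivAt_neg y)
  have hP (z : ℝ) := intervalIntegral.integral_hasDerivAt_right (hc.intervalIntegrable 0 z)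
    hc.aestronglyMeasurable.stronglyMeasurableAtFilter hc.continuousAt
  have h2 : HasDerivAt (fun y => ∫ u in y..(y + Real.pi), contourKernel x n (Complex.I * u))
      (contourKernel x n (Complex.I * (y + Real.pi : ℝ)) - contourKernel x n (Complex.I * y)) y := by
    refine (((hP (y + Real.pi)).comp_add_const y Real.pi).sub (hP y)).congr_of_eventuallyEq
      (Eventually.of_forall fun z => ?_)
    exact (intervalIntegral.integral_interval_sub_left (hc.intervalIntegrable _ _)
      (hc.intervalIntegrable _ _)).symm
  refine ((h1.add (h2.const_mul Complex.I)).add (h3.const_mul ((-1) ^ n))).congr_deriv ?_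
  have h4 := contourKernel_add_pi x n (Complex.I * y)
  rw [show Complex.I * (y : ℂ) + Real.pi * Complex.I = Complex.I * (y + Real.pi : ℝ) by
    push_cast; ring] at h4
  rw [h4]
  push_cast
  rw [neg_smul, one_smul, mul_neg Complex.I (y : ℂ)]
  ring

theorem contourIntegral_eq_contourIntegral_zero {x : ℝ} (hx : 0 < x) (n : ℤ) {y : ℝ}
    (hy : |y| < Real.pi / 2) : contourIntegral x n y = contourIntegral x n 0 := by
  have hpi := Real.pi_pos
  have hd (z : ℝ) (hz : z ∈ Set.Ioo (-(Real.pi / 2)) (Real.pi / 2)) :=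
    hasDerivAt_contourIntegral hx n (abs_lt.mpr hz)
  exact isOpen_Ioo.is_const_of_deriv_eq_zero (convex_Ioo _ _).isPreconnected
    (fun z hz => (hd z hz).differentiableAt.differentiableWithinAt)
    (fun z hz => (hd z hz).deriv) (abs_lt.mp hy) (by constructor <;> linarith)

/-- At height `0` the two half-lines are real and give the exponential integral in `Y_n`. The
vertical segment, after `u ↦ π - u`, gives Bessel's cosine integral for `J_n` and the sine integral
in `Y_n`. -/
theorem contourIntegral_zero {x : ℝ} (hx : 0 < x) (n : ℤ) :
    contourIntegral x n 0 = Real.pi * Complex.I * (-1) ^ n * hankel1 n x := by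
  have hpi : (Real.pi : ℂ) ≠ 0 := by exact_mod_cast Real.pi_ne_zero
  have hsq : ((-1 : ℂ) ^ n) * (-1) ^ n = 1 := by
    rw [← mul_zpow]; simp
  have hk (m : ℤ) (s : ℝ) : contourKernel x m (-s + Complex.I * (0 : ℝ)) =
      ((Real.exp (-(m * s)) * Real.exp (-(x * Real.sinh s)) : ℝ) : ℂ) := by
    rw [contourKernel, ← Real.exp_add]
    push_cast
    rw [mul_zero, add_zero, Complex.sinh_neg]
    congr 1
    ring
  have hI (m : ℤ) : IntegrableOn
      (fun s : ℝ => Real.exp (-(m * s)) * Real.exp (-(x * Real.sinh s))) (Set.Ioi 0) := by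
    have h := (integrableOn_contourKernel (x := x) (y := 0) m (by simpa using hx)).re
    refine h.congr (Eventually.of_forall fun s => ?_)
    simp only [hk]
    exact Complex.ofReal_re _
  have hH (m : ℤ) : halfLineIntegral x m 0 =
      ((∫ s in Set.Ioi (0 : ℝ), Real.exp (-(m * s)) * Real.exp (-(x * Real.sinh s)) : ℝ) : ℂ) := by
    rw [halfLineIntegral, ← integral_complex_ofReal]
    exact integral_congr_ae (Eventually.of_forall fun s => hk m s)
  have hY : (∫ t in Set.Ioi (0 : ℝ),
      (Real.exp (n * t) + (-1) ^ n * Real.exp (-(n * t))) * Real.exp (-(x * Real.sinh t))) =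
      (∫ s in Set.Ioi (0 : ℝ), Real.exp (-((-n : ℤ) * s)) * Real.exp (-(x * Real.sinh s))) +
      (-1) ^ n * ∫ s in Set.Ioi (0 : ℝ), Real.exp (-(n * s)) * Real.exp (-(x * Real.sinh s)) := by
    rw [← integral_const_mul, ← integral_add (hI (-n)) ((hI n).const_mul _)]
    refine integral_congr_ae (Eventually.of_forall fun s => ?_)
    simp only [Int.cast_neg, neg_mul, neg_neg]
    ring
  have hmid : (∫ u in (0 : ℝ)..(0 + Real.pi), contourKernel x n (Complex.I * u)) =
      (-1) ^ n * (((∫ t in (0 : ℝ)..Real.pi, Real.cos (x * Real.sin t - n * t) : ℝ) : ℂ) +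
        Complex.I * ((∫ t in (0 : ℝ)..Real.pi, Real.sin (x * Real.sin t - n * t) : ℝ) : ℂ)) := by
    have hrefl := intervalIntegral.integral_comp_sub_left (a := 0) (b := Real.pi)
      (fun u : ℝ => contourKernel x n (Complex.I * u)) Real.pi
    rw [sub_self, sub_zero] at hrefl
    rw [zero_add, ← hrefl, ← intervalIntegral.integral_ofReal, ← intervalIntegral.integral_ofReal,
      ← intervalIntegral.integral_const_mul, ← intervalIntegral.integral_add
        (Continuous.intervalIntegrable (by fun_prop) _ _)
        (Continuous.intervalIntegrable (by fun_prop) _ _), ← intervalIntegral.integral_const_mul]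
    refine intervalIntegral.integral_congr fun t _ => ?_
    have h4 := contourKernel_add_pi x n (-(Complex.I * t))
    rw [show Complex.I * ((Real.pi - t : ℝ) : ℂ) = -(Complex.I * t) + Real.pi * Complex.I by
      push_cast; ring, h4, neg_neg, contourKernel]
    congr 1
    rw [mul_comm Complex.I (t : ℂ), Complex.sinh_mul_I, ← Complex.ofReal_sin,
      show x * ((Real.sin t : ℂ) * Complex.I) + ((-n : ℤ) : ℂ) * (t * Complex.I) =
        ((x * Real.sin t - n * t : ℝ) : ℂ) * Complex.I by push_cast; ring, Complex.exp_mul_I,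
      Complex.ofReal_cos, Complex.ofReal_sin]
    ring
  rw [contourIntegral, neg_zero, hH, hH, hmid, hankel1, besselY, hY, pi_mul_besselJ]
  push_cast
  generalize (∫ s in Set.Ioi (0 : ℝ), Real.exp (-(n * s)) * Real.exp (-(x * Real.sinh s))) = a
  simp only [neg_mul, neg_neg]
  generalize (∫ s in Set.Ioi (0 : ℝ), Real.exp (n * s) * Real.exp (-(x * Real.sinh s))) = b
  generalize (∫ t in (0 : ℝ)..Real.pi, Real.sin (x * Real.sin t - n * t)) = d
  field_simp
  have hI2 := Complex.I_sq
  generalize (-1 : ℂ) ^ n = e at *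
  linear_combination (-(a : ℂ)) * hsq + (a * e ^ 2 + e * b) * hI2

/-! ### Sommerfeld's representation by uniformization of the square root -/

theorem integrable_of_integrableOn_three {f : ℝ → ℂ} {a b : ℝ} (hab : a ≤ b)
    (h1 : IntegrableOn f (Set.Iio a)) (h2 : IntegrableOn f (Set.Ioo a b))
    (h3 : IntegrableOn f (Set.Ioi b)) :
    Integrable f ∧ ∫ l, f l =
      (∫ l in Set.Ioi b, f l) + (∫ l in Set.Ioo a b, f l) + ∫ l in Set.Iio a, f l := by
  rw [← integrableOn_Iic_iff_integrableOn_Iio] at h1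
  rw [← integrableOn_Ioc_iff_integrableOn_Ioo] at h2
  have h12 : IntegrableOn f (Set.Iic b) := by
    rw [← Set.Iic_union_Ioc_eq_Iic hab]
    exact h1.union h2
  have h : Integrable f := by
    rw [← integrableOn_univ, ← Set.Iic_union_Ioi (a := b)]
    exact h12.union h3
  refine ⟨h, ?_⟩
  rw [← intervalIntegral.integral_Iic_add_Ioi h12 h3, ← Set.Iic_union_Ioc_eq_Iic hab,
    setIntegral_union (Set.Iic_disjoint_Ioc le_rfl) measurableSet_Ioc h1 h2,
    integral_Iic_eq_integral_Iio, integral_Ioc_eq_integral_Ioo]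
  ring

theorem image_cosh_Ioi {k : ℝ} (hk : 0 < k) :
    (fun s : ℝ => k * Real.cosh s) '' Set.Ioi 0 = Set.Ioi k := by
  ext l
  constructor
  · rintro ⟨s, hs, rfl⟩
    have := Real.one_lt_cosh.mpr (ne_of_gt hs)
    simp only [Set.mem_Ioi]
    nlinarith
  · intro hl
    have h1 : 1 < l / k := (one_lt_div hk).mpr hl
    refine ⟨Real.arcosh (l / k), Real.arcosh_pos h1, ?_⟩
    simp only
    rw [Real.cosh_arcosh h1.le]
    field_simp

theorem image_neg_cosh_Ioi {k : ℝ} (hk : 0 < k) :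
    (fun s : ℝ => -(k * Real.cosh s)) '' Set.Ioi 0 = Set.Iio (-k) := by
  rw [← Set.image_image (fun t : ℝ => -t) (fun s : ℝ => k * Real.cosh s), image_cosh_Ioi hk]
  simp

theorem image_cos_Ioo {k : ℝ} (hk : 0 < k) :
    (fun s : ℝ => k * Real.cos s) '' Set.Ioo 0 Real.pi = Set.Ioo (-k) k := by
  ext l
  constructor
  · rintro ⟨s, hs, rfl⟩
    have h1 : Real.cos s < 1 := by
      rw [← Real.cos_zero]
      exact Real.cos_lt_cos_of_nonneg_of_le_pi le_rfl hs.2.le hs.1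
    have h2 : -1 < Real.cos s := by
      rw [← Real.cos_pi]
      exact Real.cos_lt_cos_of_nonneg_of_le_pi hs.1.le le_rfl hs.2
    constructor <;> simp only <;> nlinarith
  · intro hl
    have h1 : l / k < 1 := (div_lt_one hk).mpr hl.2
    have h2 : -1 < l / k := by
      rw [lt_div_iff₀ hk]
      linarith [hl.1]
    refine ⟨Real.arccos (l / k), ⟨Real.arccos_pos.mpr h1, ?_⟩, ?_⟩
    · refine lt_of_le_of_ne (Real.arccos_le_pi _) fun h => ?_
      rw [Real.arccos_eq_pi] at h
      linarith
    · simp only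
      rw [Real.cos_arccos h2.le h1.le]
      field_simp

theorem spectralRoot_sq (k l : ℝ) : spectralRoot k l ^ 2 = (l : ℂ) ^ 2 - (k : ℂ) ^ 2 := by
  have hI := Complex.I_sq
  rw [spectralRoot]
  rcases le_total (l ^ 2) (k ^ 2) with h | h
  · have h2 : ((Real.sqrt (k ^ 2 - l ^ 2) : ℝ) : ℂ) ^ 2 = (k : ℂ) ^ 2 - (l : ℂ) ^ 2 := by
      exact_mod_cast Real.sq_sqrt (sub_nonneg.mpr h)
    rw [Real.sqrt_eq_zero_of_nonpos (sub_nonpos.mpr h)]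
    push_cast
    linear_combination (Real.sqrt (k ^ 2 - l ^ 2) : ℂ) ^ 2 * hI - h2
  · have h2 : ((Real.sqrt (l ^ 2 - k ^ 2) : ℝ) : ℂ) ^ 2 = (l : ℂ) ^ 2 - (k : ℂ) ^ 2 := by
      exact_mod_cast Real.sq_sqrt (sub_nonneg.mpr h)
    rw [Real.sqrt_eq_zero_of_nonpos (sub_nonpos.mpr h)]
    push_cast
    linear_combination h2

theorem spectralRoot_eq_of_sq_eq {k l r : ℝ} (hr : 0 ≤ r) (h : l ^ 2 - k ^ 2 = r ^ 2) :
    spectralRoot k l = r := by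
  rw [spectralRoot, h, Real.sqrt_sq hr, Real.sqrt_eq_zero_of_nonpos (by nlinarith)]
  simp

theorem spectralRoot_eq_of_sq_eq_neg {k l r : ℝ} (hr : 0 ≤ r) (h : k ^ 2 - l ^ 2 = r ^ 2) :
    spectralRoot k l = -(Complex.I * r) := by
  rw [spectralRoot, h, Real.sqrt_sq hr, Real.sqrt_eq_zero_of_nonpos (by nlinarith)]
  simp

/-- The spectral integrand in the uniformizing variable `ζ` with `l = k cosh ζ` and
`√(l² - k²) = -k sinh ζ`. -/
theorem freeSpaceInfo_mul_zpow_eq {k l : ℝ} (hk : 0 < k) (n : ℤ) (w ζ : ℂ)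
    (hl : (l : ℂ) = k * Complex.cosh ζ) (hr : spectralRoot k l = -(k * Complex.sinh ζ)) :
    freeSpaceInfo k w l * spectralZ k l ^ n =
      Complex.exp (Complex.I * n * (w.arg - (Real.pi / 2 : ℝ) : ℝ)) *
        contourKernel (k * ‖w‖) n (ζ + Complex.I * (Real.pi / 2 - w.arg : ℝ)) /
        spectralRoot k l := by
  have hk' : (k : ℂ) ≠ 0 := by exact_mod_cast hk.ne'
  have hz : spectralZ k l = Complex.exp ζ := by
    rw [spectralZ, hr, hl, sub_neg_eq_add, ← mul_add, Complex.cosh_add_sinh,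
      mul_div_cancel_left₀ _ hk']
  have hexp : Complex.exp (-(spectralRoot k l * (w.im : ℂ))) *
      Complex.exp (Complex.I * (l : ℂ) * (w.re : ℂ)) * Complex.exp ζ ^ n =
      Complex.exp (Complex.I * n * (w.arg - (Real.pi / 2 : ℝ) : ℝ)) *
        contourKernel (k * ‖w‖) n (ζ + Complex.I * (Real.pi / 2 - w.arg : ℝ)) := by
    rw [contourKernel, ← Complex.exp_int_mul, ← Complex.exp_add, ← Complex.exp_add,
      ← Complex.exp_add, hr, hl]
    congr 1
    -- The shift by `i(π/2 - θ)` merges the two exponents: multiplied by `kρ`, this is `-√(l² - k²)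
    -- η + i l ξ`.
    have h1 : Complex.sinh (ζ + Complex.I * (Real.pi / 2 - w.arg : ℝ)) =
        Complex.sinh ζ * (Real.sin w.arg : ℂ) +
          Complex.cosh ζ * ((Real.cos w.arg : ℂ) * Complex.I) := by
      rw [Complex.sinh_add, mul_comm Complex.I, Complex.cosh_mul_I, Complex.sinh_mul_I,
        ← Complex.ofReal_cos, ← Complex.ofReal_sin, Real.sin_pi_div_two_sub,
        Real.cos_pi_div_two_sub]
    rw [h1, ← Complex.norm_mul_cos_arg w, ← Complex.norm_mul_sin_arg w]
    simp only [Complex.norm_mul_cos_arg, Complex.norm_mul_sin_arg]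
    have h2 : (w.re : ℂ) = ‖w‖ * (Real.cos w.arg : ℂ) := by
      exact_mod_cast (Complex.norm_mul_cos_arg w).symm
    have h3 : (w.im : ℂ) = ‖w‖ * (Real.sin w.arg : ℂ) := by
      exact_mod_cast (Complex.norm_mul_sin_arg w).symm
    rw [h2, h3]
    push_cast
    ring
  rw [← hexp, hz, freeSpaceInfo]
  ring

/-- The branch `ζ = -s`. The Jacobian equals the root and cancels it, so the singularity at `l = k`
disappears. -/
theorem abs_smul_freeSpaceInfo_Ioi {k : ℝ} (hk : 0 < k) (n : ℤ) {s : ℝ}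
    (hs : s ∈ Set.Ioi (0 : ℝ)) (w : ℂ) :
    |k * Real.sinh s| • (freeSpaceInfo k w (k * Real.cosh s) *
        spectralZ k (k * Real.cosh s) ^ n) =
      Complex.exp (Complex.I * n * (w.arg - (Real.pi / 2 : ℝ) : ℝ)) *
        contourKernel (k * ‖w‖) n (-s + Complex.I * (Real.pi / 2 - w.arg : ℝ)) := by
  have hpos : 0 < k * Real.sinh s := mul_pos hk (Real.sinh_pos_iff.mpr hs)
  have hne : ((k * Real.sinh s : ℝ) : ℂ) ≠ 0 := by exact_mod_cast hpos.ne'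
  have hr : spectralRoot k (k * Real.cosh s) = (k * Real.sinh s : ℝ) :=
    spectralRoot_eq_of_sq_eq hpos.le (by rw [mul_pow, mul_pow, Real.cosh_sq]; ring)
  rw [freeSpaceInfo_mul_zpow_eq hk n w (-s) (by simp) (by rw [hr]; simp), hr, abs_of_pos hpos,
    Complex.real_smul, mul_div_cancel₀ _ hne]

/-- The branch `ζ = s + πi`, where `cosh` and `sinh` both change sign; `contourKernel_add_pi` then
brings it back to a left half-line. -/
theorem abs_smul_freeSpaceInfo_Iio {k : ℝ} (hk : 0 < k) (n : ℤ) {s : ℝ}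
    (hs : s ∈ Set.Ioi (0 : ℝ)) (w : ℂ) :
    |-(k * Real.sinh s)| • (freeSpaceInfo k w (-(k * Real.cosh s)) *
        spectralZ k (-(k * Real.cosh s)) ^ n) =
      Complex.exp (Complex.I * n * (w.arg - (Real.pi / 2 : ℝ) : ℝ)) * ((-1) ^ n *
        contourKernel (k * ‖w‖) (-n) (-s + Complex.I * (-(Real.pi / 2 - w.arg) : ℝ))) := by
  have hpos : 0 < k * Real.sinh s := mul_pos hk (Real.sinh_pos_iff.mpr hs)
  have hne : ((k * Real.sinh s : ℝ) : ℂ) ≠ 0 := by exact_mod_cast hpos.ne'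
  have hr : spectralRoot k (-(k * Real.cosh s)) = (k * Real.sinh s : ℝ) :=
    spectralRoot_eq_of_sq_eq hpos.le (by rw [neg_sq, mul_pow, mul_pow, Real.cosh_sq]; ring)
  have h1 : Complex.cosh (s + Real.pi * Complex.I) = -Complex.cosh s := by
    rw [Complex.cosh_add, Complex.cosh_mul_I, Complex.sinh_mul_I, Complex.sin_pi, Complex.cos_pi]
    ring
  have h2 : Complex.sinh (s + Real.pi * Complex.I) = -Complex.sinh s := by
    rw [Complex.sinh_add, Complex.cosh_mul_I, Complex.sinh_mul_I, Complex.sin_pi, Complex.cos_pi]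
    ring
  rw [freeSpaceInfo_mul_zpow_eq hk n w (s + Real.pi * Complex.I) (by rw [h1]; simp)
    (by rw [hr, h2]; simp), hr, abs_neg, abs_of_pos hpos,
    Complex.real_smul, mul_div_cancel₀ _ hne, add_right_comm, contourKernel_add_pi]
  congr 3
  push_cast
  ring

/-- The branch `ζ = is`. Here the root is `-i` times the absolute Jacobian, which leaves the factor
`i` of the vertical segment. -/
theorem abs_smul_freeSpaceInfo_Ioo {k : ℝ} (hk : 0 < k) (n : ℤ) {s : ℝ}
    (hs : s ∈ Set.Ioo (0 : ℝ) Real.pi) (w : ℂ) :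
    |k * -Real.sin s| • (freeSpaceInfo k w (k * Real.cos s) *
        spectralZ k (k * Real.cos s) ^ n) =
      Complex.exp (Complex.I * n * (w.arg - (Real.pi / 2 : ℝ) : ℝ)) * (Complex.I *
        contourKernel (k * ‖w‖) n (Complex.I * (s + (Real.pi / 2 - w.arg) : ℝ))) := by
  have hpos : 0 < k * Real.sin s := mul_pos hk (Real.sin_pos_of_mem_Ioo hs)
  have hne : ((k * Real.sin s : ℝ) : ℂ) ≠ 0 := by exact_mod_cast hpos.ne'
  have hr : spectralRoot k (k * Real.cos s) = -(Complex.I * (k * Real.sin s : ℝ)) :=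
    spectralRoot_eq_of_sq_eq_neg hpos.le (by rw [mul_pow, mul_pow, Real.cos_sq']; ring)
  rw [freeSpaceInfo_mul_zpow_eq hk n w (s * Complex.I) (by rw [Complex.cosh_mul_I]; simp)
    (by rw [hr, Complex.sinh_mul_I]; push_cast; ring), hr, mul_neg, abs_neg, abs_of_pos hpos,
    Complex.real_smul, show (s : ℂ) * Complex.I + Complex.I * (Real.pi / 2 - w.arg : ℝ) =
      Complex.I * (s + (Real.pi / 2 - w.arg) : ℝ) by push_cast; ring]
  field_simp
  rw [Complex.I_sq]
  ring

theorem integrable_freeSpaceInfo_and_integral_eq {k : ℝ} (hk : 0 < k) (n : ℤ) {w : ℂ}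
    (hw : 0 < w.im) :
    Integrable (fun l : ℝ => freeSpaceInfo k w l * spectralZ k l ^ n) ∧
      ∫ l : ℝ, freeSpaceInfo k w l * spectralZ k l ^ n =
        Complex.exp (Complex.I * n * (w.arg - (Real.pi / 2 : ℝ) : ℝ)) *
          contourIntegral (k * ‖w‖) n (Real.pi / 2 - w.arg) := by
  have hw0 : w ≠ 0 := by
    rintro rfl
    simp at hw
  have hx : 0 < k * ‖w‖ := by positivity
  -- The decay rate on both half-lines is `k η`, so integrability is exactly where `η > 0` enters.
  have hsin : 0 < k * ‖w‖ * Real.cos (Real.pi / 2 - w.arg) := by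
    rw [Real.cos_pi_div_two_sub, mul_assoc, Complex.norm_mul_sin_arg]
    positivity
  have hd1 : ∀ s ∈ Set.Ioi (0 : ℝ),
      HasDerivWithinAt (fun s => k * Real.cosh s) (k * Real.sinh s) (Set.Ioi 0) s :=
    fun s _ => ((Real.hasDerivAt_cosh s).const_mul k).hasDerivWithinAt
  have hd2 : ∀ s ∈ Set.Ioi (0 : ℝ),
      HasDerivWithinAt (fun s => -(k * Real.cosh s)) (-(k * Real.sinh s)) (Set.Ioi 0) s :=
    fun s hs => (hd1 s hs).fun_neg
  have hd3 : ∀ s ∈ Set.Ioo (0 : ℝ) Real.pi,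
      HasDerivWithinAt (fun s => k * Real.cos s) (k * -Real.sin s) (Set.Ioo 0 Real.pi) s :=
    fun s _ => ((Real.hasDerivAt_cos s).const_mul k).hasDerivWithinAt
  have hi1 : Set.InjOn (fun s => k * Real.cosh s) (Set.Ioi 0) := fun a ha b hb hab =>
    Real.cosh_injOn (Set.mem_Ici_of_Ioi ha) (Set.mem_Ici_of_Ioi hb) (mul_left_cancel₀ hk.ne' hab)
  have hi2 : Set.InjOn (fun s => -(k * Real.cosh s)) (Set.Ioi 0) := fun a ha b hb hab =>
    hi1 ha hb (neg_injective hab)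
  have hi3 : Set.InjOn (fun s => k * Real.cos s) (Set.Ioo 0 Real.pi) := fun a ha b hb hab =>
    Real.injOn_cos ⟨ha.1.le, ha.2.le⟩ ⟨hb.1.le, hb.2.le⟩ (mul_left_cancel₀ hk.ne' hab)
  set f : ℝ → ℂ := fun l => freeSpaceInfo k w l * spectralZ k l ^ n with hf
  set E : ℂ := Complex.exp (Complex.I * n * (w.arg - (Real.pi / 2 : ℝ) : ℝ)) with hE
  have hc : Continuous fun u : ℝ => contourKernel (k * ‖w‖) n (Complex.I * u) :=
    (continuous_contourKernel _ n).comp (by fun_prop)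
  have hJ1 : IntegrableOn f (Set.Ioi k) := by
    rw [← image_cosh_Ioi hk,
      integrableOn_image_iff_integrableOn_abs_deriv_smul measurableSet_Ioi hd1 hi1]
    exact IntegrableOn.congr_fun ((integrableOn_contourKernel n hsin).const_mul E)
      (fun s hs => (abs_smul_freeSpaceInfo_Ioi hk n hs w).symm) measurableSet_Ioi
  have hJ2 : IntegrableOn f (Set.Iio (-k)) := by
    rw [← image_neg_cosh_Ioi hk,
      integrableOn_image_iff_integrableOn_abs_deriv_smul measurableSet_Ioi hd2 hi2]
    exact IntegrableOn.congr_fun (((integrableOn_contourKernel (-n)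
      (by rwa [Real.cos_neg])).const_mul ((-1) ^ n)).const_mul E)
      (fun s hs => (abs_smul_freeSpaceInfo_Iio hk n hs w).symm) measurableSet_Ioi
  have hJ3 : IntegrableOn f (Set.Ioo (-k) k) := by
    rw [← image_cos_Ioo hk,
      integrableOn_image_iff_integrableOn_abs_deriv_smul measurableSet_Ioo hd3 hi3]
    have hc' : Continuous fun s : ℝ => E * (Complex.I *
        contourKernel (k * ‖w‖) n (Complex.I * (s + (Real.pi / 2 - w.arg) : ℝ))) :=
      (((hc.comp (continuous_add_const _)).const_mul _).const_mul _)
    exact IntegrableOn.congr_fun (hc'.integrableOn_Icc.mono_set Set.Ioo_subset_Icc_self)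
      (fun s hs => (abs_smul_freeSpaceInfo_Ioo hk n hs w).symm) measurableSet_Ioo
  obtain ⟨hint, heq⟩ := integrable_of_integrableOn_three (by linarith) hJ2 hJ3 hJ1
  refine ⟨hint, ?_⟩
  rw [heq, ← image_cosh_Ioi hk, ← image_neg_cosh_Ioi hk, ← image_cos_Ioo hk,
    integral_image_eq_integral_abs_deriv_smul measurableSet_Ioi hd1 hi1,
    integral_image_eq_integral_abs_deriv_smul measurableSet_Ioi hd2 hi2,
    integral_image_eq_integral_abs_deriv_smul measurableSet_Ioo hd3 hi3,
    setIntegral_congr_fun measurableSet_Ioi fun s hs => abs_smul_freeSpaceInfo_Ioi hk n hs w,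
    setIntegral_congr_fun measurableSet_Ioi fun s hs => abs_smul_freeSpaceInfo_Iio hk n hs w,
    setIntegral_congr_fun measurableSet_Ioo fun s hs => abs_smul_freeSpaceInfo_Ioo hk n hs w,
    integral_const_mul, integral_const_mul, integral_const_mul, integral_const_mul,
    integral_const_mul, contourIntegral, halfLineIntegral, halfLineIntegral,
    ← integral_Ioc_eq_integral_Ioo, ← intervalIntegral.integral_of_le Real.pi_pos.le,
    intervalIntegral.integral_comp_add_right
      (fun u : ℝ => contourKernel (k * ‖w‖) n (Complex.I * u)), zero_add,
    add_comm Real.pi (Real.pi / 2 - w.arg)]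
  ring

/-- Sommerfeld's spectral representation of the outgoing cylindrical waves. -/
theorem hankelWave_eq_integral {k : ℝ} (hk : 0 < k) (n : ℤ) {w : ℂ}
    (hw : 0 < w.im) :
    hankelWave k n w = (-Complex.I) ^ n / (Complex.I * (Real.pi : ℂ)) *
      ∫ l : ℝ, freeSpaceInfo k w l * spectralZ k l ^ n := by
  have hpi : (Real.pi : ℂ) ≠ 0 := by exact_mod_cast Real.pi_ne_zero
  have hw0 : w ≠ 0 := by
    rintro rfl
    simp at hw
  have hx : 0 < k * ‖w‖ := by positivity
  have harg : |Real.pi / 2 - w.arg| < Real.pi / 2 := by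
    have h1 : 0 < Real.sin w.arg := by
      rw [Complex.sin_arg]
      positivity
    have h2 : 0 < w.arg := by
      by_contra h
      exact absurd (Real.sin_nonpos_of_nonpos_of_neg_pi_le (not_lt.mp h)
        (Complex.neg_pi_lt_arg w).le) (not_le.mpr h1)
    have h3 : w.arg < Real.pi := by
      refine lt_of_le_of_ne (Complex.arg_le_pi w) fun h => ?_
      rw [h, Real.sin_pi] at h1
      exact lt_irrefl _ h1
    rw [abs_lt]
    constructor <;> linarith
  have hE : Complex.exp (Complex.I * n * (w.arg - (Real.pi / 2 : ℝ) : ℝ)) =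
      (-Complex.I) ^ n * Complex.exp (Complex.I * n * (w.arg : ℂ)) := by
    have h1 : (-Complex.I) = Complex.exp (-(Real.pi / 2) * Complex.I) := by
      rw [Complex.exp_mul_I, Complex.cos_neg, Complex.sin_neg, Complex.cos_pi_div_two,
        Complex.sin_pi_div_two]
      ring
    rw [h1, ← Complex.exp_int_mul, ← Complex.exp_add]
    congr 1
    push_cast
    ring
  -- One `(-i)^n` is the prefactor, one the phase from the shift by `π/2`, and `(-1)^n` comes from
  -- `contourIntegral_zero`.
  have hunit : (-Complex.I) ^ n * (-Complex.I) ^ n * (-1) ^ n = 1 := by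
    rw [← mul_zpow, ← mul_zpow]
    simp
  rw [(integrable_freeSpaceInfo_and_integral_eq hk n hw).2, hE,
    contourIntegral_eq_contourIntegral_zero hx n harg, contourIntegral_zero hx, hankelWave]
  have hI := Complex.I_ne_zero
  field_simp
  linear_combination (-hankel1 n (k * ‖w‖)) * hunit

/-! ### A Riemann-Lebesgue lemma for the spectral root -/

theorem continuous_spectralRoot (k : ℝ) : Continuous (spectralRoot k) := by
  unfold spectralRoot
  fun_prop

theorem spectralRoot_re (k l : ℝ) : (spectralRoot k l).re = Real.sqrt (l ^ 2 - k ^ 2) := by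
  simp [spectralRoot]

theorem spectralRoot_im (k l : ℝ) : (spectralRoot k l).im = -Real.sqrt (k ^ 2 - l ^ 2) := by
  simp [spectralRoot]

theorem spectralRoot_re_nonneg (k l : ℝ) : 0 ≤ (spectralRoot k l).re := by
  rw [spectralRoot_re]
  exact Real.sqrt_nonneg _

theorem spectralRoot_neg (k l : ℝ) : spectralRoot k (-l) = spectralRoot k l := by
  simp [spectralRoot]

theorem ae_spectralRoot_ne_zero (k : ℝ) : ∀ᵐ l : ℝ, spectralRoot k l ≠ 0 := by
  have h : ({k, -k} : Set ℝ).Finite := Set.toFinite _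
  filter_upwards [h.measure_zero volume |> compl_mem_ae_iff.mpr] with l hl h0
  have h1 := spectralRoot_sq k l
  rw [h0] at h1
  have h2 : l ^ 2 = k ^ 2 := by
    have : (l : ℂ) ^ 2 = (k : ℂ) ^ 2 := by linear_combination -h1
    exact_mod_cast this
  rcases sq_eq_sq_iff_eq_or_eq_neg.mp h2 with h | h <;> simp [h] at hl

theorem norm_exp_neg_spectralRoot_le_one (k l : ℝ) {S : ℝ} (hS : 0 ≤ S) :
    ‖Complex.exp (-(spectralRoot k l * S))‖ ≤ 1 := by
  rw [Complex.norm_exp, Real.exp_le_one_iff, Complex.neg_re, Complex.re_mul_ofReal]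
  have := mul_nonneg (spectralRoot_re_nonneg k l) hS
  linarith

theorem freeSpaceInfo_add_mul_I (k : ℝ) (w : ℂ) (s l : ℝ) :
    freeSpaceInfo k (w + s * Complex.I) l =
      freeSpaceInfo k w l * Complex.exp (-(spectralRoot k l * s)) := by
  have h1 : (w + s * Complex.I).im = w.im + s := by simp
  have h2 : (w + s * Complex.I).re = w.re := by simp
  rw [freeSpaceInfo, freeSpaceInfo, h1, h2]
  push_cast
  rw [mul_add, neg_add, Complex.exp_add]
  ring

/-- The map `v ↦ √(k² - v²)` is an involution of `(0, k)`. -/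
theorem image_sqrt_Ioo {k : ℝ} (hk : 0 < k) :
    (fun v : ℝ => Real.sqrt (k ^ 2 - v ^ 2)) '' Set.Ioo 0 k = Set.Ioo 0 k := by
  have hmaps (v : ℝ) (hv : v ∈ Set.Ioo 0 k) : Real.sqrt (k ^ 2 - v ^ 2) ∈ Set.Ioo 0 k := by
    refine ⟨Real.sqrt_pos.mpr (by nlinarith [hv.1, hv.2]), ?_⟩
    rw [Real.sqrt_lt' hk]
    nlinarith [hv.1]
  ext l
  constructor
  · rintro ⟨v, hv, rfl⟩
    exact hmaps v hv
  · intro hl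
    refine ⟨_, hmaps l hl, ?_⟩
    simp only
    rw [Real.sq_sqrt (by nlinarith [hl.1, hl.2]), sub_sub_cancel, Real.sqrt_sq hl.1.le]

/-- No integrability is needed: multiplying by a unimodular factor preserves nonintegrability, and
then all the integrals are `0` by convention. -/
theorem tendsto_integral_exp_mul_I (f : ℝ → ℂ) :
    Tendsto (fun S : ℝ => ∫ v : ℝ, Complex.exp (Complex.I * v * S) * f v) atTop (𝓝 0) := by
  have h := (Real.tendsto_integral_exp_smul_cocompact f).mono_left atBot_le_cocompact
  have h2 : Tendsto (fun S : ℝ => -(1 / (2 * Real.pi)) * S) atTop atBot :=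
    tendsto_id.const_mul_atTop_of_neg (by simp [Real.pi_pos])
  refine (h.comp h2).congr fun S => ?_
  refine integral_congr_ae (Eventually.of_forall fun v => ?_)
  simp only [Circle.smul_def, Real.fourierChar_apply, smul_eq_mul]
  congr 2
  push_cast
  have : (Real.pi : ℂ) ≠ 0 := by exact_mod_cast Real.pi_ne_zero
  field_simp

/-- Oscillatory decay on the propagating part of the spectrum. -/
theorem tendsto_intervalIntegral_exp_spectralRoot {k : ℝ} (hk : 0 < k) (f : ℝ → ℂ) :
    Tendsto (fun S : ℝ => ∫ l in (0 : ℝ)..k, f l * Complex.exp (-(spectralRoot k l * S)))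
      atTop (𝓝 0) := by
  have hd : ∀ v ∈ Set.Ioo 0 k, HasDerivWithinAt (fun v : ℝ => Real.sqrt (k ^ 2 - v ^ 2))
      (-(2 * v) / (2 * Real.sqrt (k ^ 2 - v ^ 2))) (Set.Ioo 0 k) v := fun v hv => by
    have h1 : HasDerivAt (fun v : ℝ => k ^ 2 - v ^ 2) (-(2 * v)) v := by
      simpa using (hasDerivAt_pow 2 v).const_sub (k ^ 2)
    exact (h1.sqrt (by nlinarith [hv.1, hv.2])).hasDerivWithinAt
  have hi : Set.InjOn (fun v : ℝ => Real.sqrt (k ^ 2 - v ^ 2)) (Set.Ioo 0 k) := by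
    intro a ha b hb hab
    have h1 := (Real.sqrt_inj (by nlinarith [ha.1, ha.2]) (by nlinarith [hb.1, hb.2])).mp hab
    nlinarith [ha.1, hb.1]
  -- With `l = √(k² - v²)` the root is `-iv`, so the phase becomes linear and the classical lemma
  -- applies.
  refine (tendsto_integral_exp_mul_I ((Set.Ioo 0 k).indicator fun v =>
    |-(2 * v) / (2 * Real.sqrt (k ^ 2 - v ^ 2))| • f (Real.sqrt (k ^ 2 - v ^ 2)))).congr fun S => ?_
  rw [intervalIntegral.integral_of_le hk.le, integral_Ioc_eq_integral_Ioo]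
  conv_rhs => rw [← image_sqrt_Ioo hk]
  rw [integral_image_eq_integral_abs_deriv_smul measurableSet_Ioo hd hi,
    ← integral_indicator measurableSet_Ioo]
  refine integral_congr_ae (Eventually.of_forall fun v => ?_)
  by_cases hv : v ∈ Set.Ioo 0 k
  · simp only [Set.indicator_of_mem hv]
    rw [spectralRoot_eq_of_sq_eq_neg (r := v) hv.1.le
      (by rw [Real.sq_sqrt (by nlinarith [hv.1, hv.2])]; ring), neg_mul, neg_neg, mul_smul_comm,
      mul_comm (Complex.exp _)]
  · simp only [Set.indicator_of_notMem hv, mul_zero]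

/-- A Riemann-Lebesgue lemma for the phase `√(l² - k²)`. -/
theorem tendsto_integral_exp_spectralRoot {k : ℝ} (hk : 0 < k) {f : ℝ → ℂ} (hf : Integrable f) :
    Tendsto (fun S : ℝ => ∫ l, f l * Complex.exp (-(spectralRoot k l * S))) atTop (𝓝 0) := by
  have hcont (S : ℝ) : Continuous fun l : ℝ => Complex.exp (-(spectralRoot k l * S)) := by
    have := continuous_spectralRoot k
    fun_prop
  have hint (S : ℝ) (hS : 0 ≤ S) :
      Integrable fun l => f l * Complex.exp (-(spectralRoot k l * S)) :=
    hf.mul_bdd (c := 1) (hcont S).aestronglyMeasurable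
      (Eventually.of_forall fun l => norm_exp_neg_spectralRoot_le_one k l hS)
  have hneg : Tendsto (fun S : ℝ => ∫ l in (-k)..0, f l * Complex.exp (-(spectralRoot k l * S)))
      atTop (𝓝 0) := by
    refine (tendsto_intervalIntegral_exp_spectralRoot hk fun l => f (-l)).congr fun S => ?_
    have := intervalIntegral.integral_comp_neg (a := 0) (b := k)
      fun l => f l * Complex.exp (-(spectralRoot k l * S))
    simpa only [spectralRoot_neg, neg_zero] using this
  -- Outside the propagating band the root is real and positive almost everywhere, so the integrand
  -- decays pointwise under the majorant `‖f‖`.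
  have hout : Tendsto (fun S : ℝ => ∫ l in (Set.Ioc (-k) k)ᶜ,
      f l * Complex.exp (-(spectralRoot k l * S))) atTop (𝓝 0) := by
    have h := tendsto_integral_filter_of_dominated_convergence
      (μ := volume.restrict (Set.Ioc (-k) k)ᶜ) (l := atTop) (f := fun _ => (0 : ℂ))
      (F := fun (S : ℝ) l => f l * Complex.exp (-(spectralRoot k l * S))) (fun l => ‖f l‖)
      (Eventually.of_forall fun S =>
        hf.aestronglyMeasurable.restrict.mul (hcont S).aestronglyMeasurable)
      (by
        filter_upwards [eventually_ge_atTop 0] with S hS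
        refine Eventually.of_forall fun l => ?_
        rw [norm_mul]
        exact mul_le_of_le_one_right (norm_nonneg _) (norm_exp_neg_spectralRoot_le_one k l hS))
      hf.norm.integrableOn
      (by
        filter_upwards [ae_restrict_mem measurableSet_Ioc.compl,
          ae_restrict_of_ae (ae_spectralRoot_ne_zero k)] with l hl hl0
        have hkl : k ^ 2 ≤ l ^ 2 := by
          by_contra! h
          obtain ⟨h1, h2⟩ := abs_lt_of_sq_lt_sq' h hk.le
          exact hl ⟨h1, h2.le⟩
        have hreal : spectralRoot k l = ((spectralRoot k l).re : ℂ) := by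
          apply Complex.ext <;> simp [spectralRoot_im, Real.sqrt_eq_zero_of_nonpos, hkl]
        have hpos : 0 < (spectralRoot k l).re := by
          refine lt_of_le_of_ne (spectralRoot_re_nonneg k l) fun h => hl0 ?_
          rw [hreal, ← h, Complex.ofReal_zero]
        rw [← mul_zero (f l)]
        refine Tendsto.const_mul _ (tendsto_zero_iff_norm_tendsto_zero.mpr ?_)
        simp_rw [Complex.norm_exp, Complex.neg_re, Complex.re_mul_ofReal]
        exact Real.tendsto_exp_neg_atTop_nhds_zero.comp (tendsto_id.const_mul_atTop hpos))
    simpa using h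
  have hsum := (hout.add (hneg.add (tendsto_intervalIntegral_exp_spectralRoot hk f)))
  rw [add_zero, add_zero] at hsum
  refine hsum.congr' ?_
  filter_upwards [eventually_ge_atTop 0] with S hS
  have hI := hint S hS
  rw [intervalIntegral.integral_add_adjacent_intervals hI.intervalIntegrable hI.intervalIntegrable,
    intervalIntegral.integral_of_le (by linarith), add_comm,
    integral_add_compl measurableSet_Ioc hI]

/-! ### The reflection factor as the effect of the line image -/

/-- The root has nonnegative real part and imaginary part in `[-k, 0]`. A positive `Im α` separates
it from `iα` by real parts, a real `α > 0` or `α < -k` by imaginary parts. For real `α` in `[-k, 0]`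
the denominator has a real zero; of these values only `α = 0` is admitted, and it is treated apart.
-/
theorem exists_le_norm_spectralRoot_sub (k : ℝ) {α : ℂ}
    (hα : 0 < α.im ∨ (α.im = 0 ∧ (0 ≤ α.re ∨ α.re < -k))) (hα0 : α ≠ 0) (hk : 0 < k) :
    ∃ δ > 0, ∀ l : ℝ, δ ≤ ‖spectralRoot k l - Complex.I * α‖ := by
  rcases hα with h | ⟨h, h2 | h2⟩
  · refine ⟨α.im, h, fun l => le_trans ?_ (Complex.re_le_norm _)⟩
    have := spectralRoot_re_nonneg k l
    simpa using this
  · have hpos : 0 < α.re := lt_of_le_of_ne h2 fun h3 => hα0 (Complex.ext h3.symm h)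
    refine ⟨α.re, hpos, fun l => le_trans ?_ ((neg_le_abs _).trans (Complex.abs_im_le_norm _))⟩
    simp [spectralRoot_im, Real.sqrt_nonneg]
  · refine ⟨-k - α.re, by linarith, fun l => le_trans ?_
      ((le_abs_self _).trans (Complex.abs_im_le_norm _))⟩
    have : Real.sqrt (k ^ 2 - l ^ 2) ≤ k := Real.sqrt_le_iff.mpr ⟨hk.le, by nlinarith⟩
    simp [spectralRoot_im]
    linarith

theorem measurable_imageInfo (k : ℝ) (α : ℂ) : Measurable (imageInfo k α) := by
  have := (continuous_spectralRoot k).measurable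
  unfold imageInfo
  fun_prop

theorem imageInfo_zero {k l : ℝ} (h : spectralRoot k l ≠ 0) : imageInfo k 0 l = 1 := by
  simp [imageInfo, h]

theorem imageInfo_eq {k l : ℝ} {α : ℂ} (h : spectralRoot k l - Complex.I * α ≠ 0) :
    imageInfo k α l = 1 + 2 * Complex.I * α / (spectralRoot k l - Complex.I * α) := by
  rw [imageInfo]
  field_simp
  ring

theorem exists_norm_imageInfo_le {k : ℝ} (hk : 0 < k) {α : ℂ}
    (hα : 0 < α.im ∨ (α.im = 0 ∧ (0 ≤ α.re ∨ α.re < -k))) :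
    ∃ M, ∀ l : ℝ, ‖imageInfo k α l‖ ≤ M := by
  by_cases hα0 : α = 0
  · subst hα0
    refine ⟨1, fun l => ?_⟩
    by_cases h : spectralRoot k l = 0
    · simp [imageInfo, h]
    · simp [imageInfo_zero h]
  · obtain ⟨δ, hδ, hle⟩ := exists_le_norm_spectralRoot_sub k hα hα0 hk
    refine ⟨1 + 2 * ‖α‖ / δ, fun l => ?_⟩
    rw [imageInfo_eq (norm_pos_iff.mp (hδ.trans_le (hle l)))]
    refine (norm_add_le _ _).trans ?_
    rw [norm_one, norm_div, norm_mul, norm_mul]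
    have := hle l
    simp only [Complex.norm_ofNat, Complex.norm_I, mul_one]
    gcongr

theorem integrable_mul_imageInfo {k : ℝ} (hk : 0 < k) {α : ℂ}
    (hα : 0 < α.im ∨ (α.im = 0 ∧ (0 ≤ α.re ∨ α.re < -k))) {f : ℝ → ℂ} (hf : Integrable f) :
    Integrable fun l => f l * imageInfo k α l := by
  obtain ⟨M, hM⟩ := exists_norm_imageInfo_le hk hα
  exact hf.mul_bdd (measurable_imageInfo k α).aestronglyMeasurable (Eventually.of_forall hM)

theorem norm_exp_I_mul_le_one {α : ℂ} (hα : 0 ≤ α.im) {s : ℝ} (hs : 0 ≤ s) :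
    ‖Complex.exp (Complex.I * α * s)‖ ≤ 1 := by
  rw [Complex.norm_exp, Real.exp_le_one_iff, Complex.re_mul_ofReal]
  have := mul_nonneg hα hs
  simpa using this

/-- Fubini's theorem for the line image over a finite segment. -/
theorem intervalIntegral_lineImage {k : ℝ} {α : ℂ} (hα : 0 ≤ α.im)
    (hne : ∀ l : ℝ, spectralRoot k l - Complex.I * α ≠ 0) {f : ℝ → ℂ} (hf : Integrable f)
    {S : ℝ} (hS : 0 ≤ S) :
    IntervalIntegrable (fun s : ℝ => (∫ l, f l * Complex.exp (-(spectralRoot k l * s))) *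
      lineImage α s) volume 0 S ∧
    ∫ s in (0 : ℝ)..S, (∫ l, f l * Complex.exp (-(spectralRoot k l * s))) * lineImage α s =
      ∫ l, f l * (2 * Complex.I * α / (spectralRoot k l - Complex.I * α) *
        (1 - Complex.exp (Complex.I * α * S) * Complex.exp (-(spectralRoot k l * S)))) := by
  have hroot := continuous_spectralRoot k
  let F : ℝ → ℝ → ℂ := fun s l => f l * Complex.exp (-(spectralRoot k l * s)) * lineImage α s
  have hmeas : AEStronglyMeasurable (Function.uncurry F)
      ((volume.restrict (Set.Ioc 0 S)).prod volume) := by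
    have h1 : Continuous fun p : ℝ × ℝ => Complex.exp (-(spectralRoot k p.2 * p.1)) := by fun_prop
    have h2 : Continuous fun p : ℝ × ℝ => lineImage α p.1 := by
      unfold lineImage
      fun_prop
    exact (hf.aestronglyMeasurable.comp_snd.mul h1.aestronglyMeasurable).mul
      h2.aestronglyMeasurable
  -- Both exponentials have modulus at most `1` for `s ≥ 0`, so `2‖α‖‖f‖` is an integrable majorant
  -- on the finite strip.
  have hF : Integrable (Function.uncurry F) ((volume.restrict (Set.Ioc 0 S)).prod volume) := by
    have hb : Integrable (fun p : ℝ × ℝ => (2 * ‖α‖) * ‖f p.2‖)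
        ((volume.restrict (Set.Ioc 0 S)).prod volume) :=
      Integrable.mul_prod (f := fun _ : ℝ => 2 * ‖α‖) (g := fun l => ‖f l‖)
        (integrable_const _) hf.norm
    refine hb.mono' hmeas ?_
    have hmem : ∀ᵐ p : ℝ × ℝ ∂((volume.restrict (Set.Ioc 0 S)).prod volume),
        p.1 ∈ Set.Ioc 0 S :=
      Measure.quasiMeasurePreserving_fst.ae (ae_restrict_mem measurableSet_Ioc)
    filter_upwards [hmem] with p hp
    have h1 := norm_exp_neg_spectralRoot_le_one k p.2 hp.1.le
    have h2 := norm_exp_I_mul_le_one hα hp.1.le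
    simp only [Function.uncurry, F, lineImage, norm_mul, Complex.norm_ofNat, Complex.norm_I,
      mul_one]
    calc _ ≤ ‖f p.2‖ * 1 * (2 * ‖α‖ * 1) := by gcongr
      _ = _ := by ring
  have hinner (s : ℝ) : ∫ l, F s l =
      (∫ l, f l * Complex.exp (-(spectralRoot k l * s))) * lineImage α s := by
    simp only [F]
    rw [integral_mul_const]
  constructor
  · rw [intervalIntegrable_iff_integrableOn_Ioc_of_le hS]
    exact hF.integral_prod_left.congr (Eventually.of_forall hinner)
  · rw [intervalIntegral.integral_of_le hS]
    simp_rw [← hinner]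
    rw [integral_integral_swap hF]
    refine integral_congr_ae (Eventually.of_forall fun l => ?_)
    simp only
    rw [← intervalIntegral.integral_of_le hS]
    have hne' : Complex.I * α - spectralRoot k l ≠ 0 := fun h => hne l (by linear_combination -h)
    have hrew (s : ℝ) : F s l = f l * (2 * Complex.I * α) *
        Complex.exp ((Complex.I * α - spectralRoot k l) * s) := by
      simp only [F, lineImage]
      rw [sub_mul, sub_eq_add_neg, Complex.exp_add]
      ring
    simp_rw [hrew]
    rw [intervalIntegral.integral_const_mul, integral_exp_mul_complex hne', sub_mul,
      sub_eq_add_neg (Complex.I * α * S), Complex.exp_add]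
    have := hne l
    simp only [Complex.ofReal_zero, mul_zero, Complex.exp_zero]
    rw [← neg_sub (spectralRoot k l)]
    field_simp
    ring

/-- The image source together with its line image multiplies the spectrum by the reflection
factor. -/
theorem improperIntegral_lineImage {k : ℝ} (hk : 0 < k) {α : ℂ}
    (hα : 0 < α.im ∨ (α.im = 0 ∧ (0 ≤ α.re ∨ α.re < -k))) {f : ℝ → ℂ} (hf : Integrable f)
    {H : ℝ → ℂ} (hH : ∀ s : ℝ, 0 ≤ s → H s = ∫ l, f l * Complex.exp (-(spectralRoot k l * s))) :
    (ImproperConverges fun s => H s * lineImage α s) ∧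
      H 0 + (improperIntegral fun s => H s * lineImage α s) = ∫ l, f l * imageInfo k α l := by
  have hH0 : H 0 = ∫ l, f l := by simp [hH 0 le_rfl]
  -- The line image vanishes, and the reflection factor is `1` except at `l = ±k`, where the
  -- quotient is `0/0 = 0`.
  by_cases hα0 : α = 0
  · subst hα0
    have h0 : (fun s => H s * lineImage 0 s) = fun _ => 0 := by
      ext s
      simp [lineImage]
    rw [h0]
    refine ⟨⟨fun S _ => by simp, 0, by simp⟩, ?_⟩
    have h1 : improperIntegral (fun _ => 0) = 0 := by
      rw [improperIntegral]
      simpa using (tendsto_const_nhds (x := (0 : ℂ)) (f := (atTop : Filter ℝ))).limUnder_eq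
    rw [h1, add_zero, hH0]
    refine integral_congr_ae ?_
    filter_upwards [ae_spectralRoot_ne_zero k] with l hl
    rw [imageInfo_zero hl, mul_one]
  obtain ⟨δ, hδ, hle⟩ := exists_le_norm_spectralRoot_sub k hα hα0 hk
  have hne (l : ℝ) : spectralRoot k l - Complex.I * α ≠ 0 := norm_pos_iff.mp (hδ.trans_le (hle l))
  have hαim : 0 ≤ α.im := by
    rcases hα with h | h
    · exact h.le
    · exact h.1.ge
  have hroot := continuous_spectralRoot k
  let m : ℝ → ℂ := fun l => 2 * Complex.I * α / (spectralRoot k l - Complex.I * α)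
  have hm : Continuous m := Continuous.div (by fun_prop) (by fun_prop) hne
  have hfm : Integrable fun l => f l * m l := by
    refine hf.mul_bdd (c := 2 * ‖α‖ / δ) hm.aestronglyMeasurable (Eventually.of_forall fun l => ?_)
    simp only [m, norm_div, norm_mul, Complex.norm_ofNat, Complex.norm_I, mul_one]
    have := hle l
    gcongr
  have hfin (S : ℝ) (hS : 0 ≤ S) := intervalIntegral_lineImage hαim hne hf hS
  have hEq (S : ℝ) (hS : 0 ≤ S) : ∫ s in (0 : ℝ)..S, H s * lineImage α s =
      (∫ l, f l * m l) - Complex.exp (Complex.I * α * S) *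
        ∫ l, f l * m l * Complex.exp (-(spectralRoot k l * S)) := by
    have hint : Integrable fun l => f l * m l * Complex.exp (-(spectralRoot k l * S)) :=
      hfm.mul_bdd (c := 1) (by fun_prop : Continuous _).aestronglyMeasurable
        (Eventually.of_forall fun l => norm_exp_neg_spectralRoot_le_one k l hS)
    rw [← integral_const_mul, ← integral_sub hfm (hint.const_mul _),
      intervalIntegral.integral_congr (g := fun s : ℝ =>
        (∫ l, f l * Complex.exp (-(spectralRoot k l * s))) * lineImage α s), (hfin S hS).2]
    · refine integral_congr_ae (Eventually.of_forall fun l => ?_)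
      simp only [m]
      ring
    · intro s hs
      rw [Set.uIcc_of_le hS] at hs
      simp only [hH s hs.1]
  have hlim : Tendsto (fun S : ℝ => ∫ s in (0 : ℝ)..S, H s * lineImage α s) atTop
      (𝓝 (∫ l, f l * m l)) := by
    -- For real `α` the factor `e^{iαS}` has modulus `1`, so the decay must come from the spectral
    -- integral.
    have h1 : Tendsto (fun S : ℝ => Complex.exp (Complex.I * α * S) *
        ∫ l, f l * m l * Complex.exp (-(spectralRoot k l * S))) atTop (𝓝 0) := by
      refine squeeze_zero_norm' ?_
        (tendsto_zero_iff_norm_tendsto_zero.mp (tendsto_integral_exp_spectralRoot hk hfm))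
      filter_upwards [eventually_ge_atTop 0] with S hS
      rw [norm_mul]
      exact mul_le_of_le_one_left (norm_nonneg _) (norm_exp_I_mul_le_one hαim hS)
    have h2 := (tendsto_const_nhds (x := ∫ l, f l * m l)).sub h1
    rw [sub_zero] at h2
    refine h2.congr' ?_
    filter_upwards [eventually_ge_atTop 0] with S hS
    exact (hEq S hS).symm
  refine ⟨⟨fun S hS => ?_, _, hlim⟩, ?_⟩
  · refine (hfin S hS).1.congr fun s hs => ?_
    rw [Set.uIoc_of_le hS] at hs
    simp only [hH s hs.1.le]
  · rw [improperIntegral, hlim.limUnder_eq, hH0, ← integral_add hf hfm]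
    refine integral_congr_ae (Eventually.of_forall fun l => ?_)
    simp only [m]
    rw [imageInfo_eq (hne l)]
    ring

/-! ### The spectral variable and the Laurent expansion of the source factor -/

theorem spectralZ_mul (k l : ℝ) (hk : k ≠ 0) :
    spectralZ k l * (((l : ℂ) + spectralRoot k l) / k) = 1 := by
  have hk' : (k : ℂ) ≠ 0 := by exact_mod_cast hk
  rw [spectralZ]
  field_simp
  linear_combination -spectralRoot_sq k l

theorem spectralZ_ne_zero {k : ℝ} (hk : k ≠ 0) (l : ℝ) : spectralZ k l ≠ 0 :=
  left_ne_zero_of_mul_eq_one (spectralZ_mul k l hk)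

theorem inv_spectralZ {k : ℝ} (hk : k ≠ 0) (l : ℝ) :
    (spectralZ k l)⁻¹ = ((l : ℂ) + spectralRoot k l) / k :=
  inv_eq_of_mul_eq_one_right (spectralZ_mul k l hk)

/-- For `|l| ≤ k` one has `|z| = 1` and the left side is `k`; beyond, it is `|l| ≤ k + √(l² - k²)`.
This converts the bound on the generating series into exponential growth in the root. -/
theorem norm_spectralZ_add_norm_inv_le {k : ℝ} (hk : 0 < k) (l : ℝ) :
    k / 2 * (‖spectralZ k l‖ + ‖spectralZ k l‖⁻¹) ≤ k + (spectralRoot k l).re := by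
  rw [← norm_inv, inv_spectralZ hk.ne', spectralZ, norm_div, norm_div, Complex.norm_real,
    Real.norm_of_nonneg hk.le, ← add_div, div_mul_div_comm, mul_comm 2 k,
    mul_div_mul_left _ _ hk.ne', div_le_iff₀ two_pos]
  have hsq (u : ℂ) : ‖u‖ ^ 2 = u.re ^ 2 + u.im ^ 2 := by
    rw [Complex.sq_norm, Complex.normSq_apply]
    ring
  rcases le_total (l ^ 2) (k ^ 2) with h | h
  · have h1 : ‖(l : ℂ) - spectralRoot k l‖ ≤ k := by
      refine le_of_sq_le_sq ?_ hk.le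
      rw [hsq]
      simp [spectralRoot_re, spectralRoot_im, Real.sqrt_eq_zero_of_nonpos (sub_nonpos.mpr h),
        Real.sq_sqrt (sub_nonneg.mpr h)]
    have h2 : ‖(l : ℂ) + spectralRoot k l‖ ≤ k := by
      refine le_of_sq_le_sq ?_ hk.le
      rw [hsq]
      simp [spectralRoot_re, spectralRoot_im, Real.sqrt_eq_zero_of_nonpos (sub_nonpos.mpr h),
        Real.sq_sqrt (sub_nonneg.mpr h)]
    have := spectralRoot_re_nonneg k l
    linarith
  · have hkl : k ≤ |l| := by
      rw [← abs_of_pos hk]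
      exact sq_le_sq.mp h
    set r := Real.sqrt (l ^ 2 - k ^ 2) with hr
    have hr0 : 0 ≤ r := Real.sqrt_nonneg _
    have hr2 : r ^ 2 = l ^ 2 - k ^ 2 := Real.sq_sqrt (sub_nonneg.mpr h)
    have hroot : spectralRoot k l = (r : ℂ) := spectralRoot_eq_of_sq_eq hr0 hr2.symm
    have hl2 : |l| ^ 2 = l ^ 2 := sq_abs l
    have hlr : |l| ≤ k + r := le_of_sq_le_sq (by nlinarith) (by linarith)
    have hrl : r ≤ |l| := le_of_sq_le_sq (by nlinarith) (abs_nonneg l)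
    rw [hroot, Complex.ofReal_re, ← Complex.ofReal_sub, ← Complex.ofReal_add, Complex.norm_real,
      Complex.norm_real, Real.norm_eq_abs, Real.norm_eq_abs]
    rcases abs_cases l with ⟨hl, _⟩ | ⟨hl, _⟩ <;> rcases abs_cases (l - r) with ⟨h1, _⟩ | ⟨h1, _⟩ <;>
      rcases abs_cases (l + r) with ⟨h2, _⟩ | ⟨h2, _⟩ <;> rw [h1, h2] <;> linarith

/-- The argument of the Bessel generating function belonging to a source in the direction
of `d`. -/
noncomputable def sourcePhase (d z : ℂ) : ℂ :=
  -Complex.I * z * Complex.exp (Complex.I * (d.arg : ℂ))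

theorem sourcePhase_ne_zero (d : ℂ) {z : ℂ} (hz : z ≠ 0) : sourcePhase d z ≠ 0 :=
  mul_ne_zero (mul_ne_zero (neg_ne_zero.mpr Complex.I_ne_zero) hz) (Complex.exp_ne_zero _)

theorem norm_sourcePhase (d z : ℂ) : ‖sourcePhase d z‖ = ‖z‖ := by
  simp [sourcePhase, Complex.norm_exp]

theorem norm_mul_exp_I_mul_arg (d : ℂ) : ‖d‖ * Complex.exp (Complex.I * (d.arg : ℂ)) = d := by
  rw [mul_comm Complex.I, Complex.norm_mul_exp_arg_mul_I]

theorem norm_mul_sourcePhase (d z : ℂ) : ‖d‖ * sourcePhase d z = -Complex.I * z * d := by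
  conv_rhs => rw [← norm_mul_exp_I_mul_arg d]
  rw [sourcePhase]
  ring

theorem norm_mul_inv_sourcePhase (d z : ℂ) :
    ‖d‖ * (sourcePhase d z)⁻¹ = Complex.I * z⁻¹ * conj d := by
  conv_rhs => rw [← norm_mul_exp_I_mul_arg d]
  rw [sourcePhase, mul_inv, mul_inv, ← Complex.exp_neg, inv_neg, Complex.inv_I, map_mul,
    Complex.conj_ofReal, ← Complex.exp_conj, map_mul, Complex.conj_I, Complex.conj_ofReal, neg_neg,
    neg_mul]
  ring

/-- Since `z + 1/z = 2l/k` and `z - 1/z = -2√(l² - k²)/k`, the exponent `-i(k/2)(z d + z⁻¹ d̄)`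
splits into `-i l Re d - √(l² - k²) Im d`. -/
theorem exp_sourcePhase {k : ℝ} (hk : k ≠ 0) (d : ℂ) (l : ℝ) :
    Complex.exp ((k * ‖d‖ : ℝ) / 2 *
        (sourcePhase d (spectralZ k l) - (sourcePhase d (spectralZ k l))⁻¹)) =
      Complex.exp (-(spectralRoot k l * (d.im : ℂ))) *
        Complex.exp (Complex.I * (l : ℂ) * ((-d.re : ℝ) : ℂ)) := by
  have hk' : (k : ℂ) ≠ 0 := by exact_mod_cast hk
  rw [← Complex.exp_add]
  congr 1
  have h1 : ((k * ‖d‖ : ℝ) : ℂ) / 2 *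
      (sourcePhase d (spectralZ k l) - (sourcePhase d (spectralZ k l))⁻¹) =
      k / 2 * (‖d‖ * sourcePhase d (spectralZ k l) -
        ‖d‖ * (sourcePhase d (spectralZ k l))⁻¹) := by
    push_cast
    ring
  rw [h1, norm_mul_sourcePhase, norm_mul_inv_sourcePhase, inv_spectralZ hk, spectralZ]
  have h2 : conj d = d.re - d.im * Complex.I := by
    apply Complex.ext <;> simp
  have h3 : d = d.re + d.im * Complex.I := (Complex.re_add_im d).symm
  rw [h2]
  conv_lhs => rw [h3]
  simp only [Complex.add_re, Complex.ofReal_re, Complex.mul_re, Complex.I_re, mul_zero,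
    Complex.ofReal_im, Complex.I_im, mul_one, sub_self, add_zero, Complex.add_im, Complex.mul_im,
    zero_add]
  push_cast
  field_simp
  linear_combination (2 * spectralRoot k l * d.im) * Complex.I_sq

/-- Conjugation turns `e^{-ipθ}` into `e^{ipθ}` and leaves the real `q_j` and `J_p` unchanged; the
three `p`-th powers then combine into one power of `sourcePhase`. -/
theorem conj_multipoleCoeff_mul {N : ℕ} (k : ℝ) (q : Fin N → ℝ) (X : Fin N → ℂ) (c : ℂ) (p : ℤ)
    (z : ℂ) : conj (multipoleCoeff k q X c p) * (-Complex.I) ^ p * z ^ p =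
      ∑ j, (q j : ℂ) * ((besselJ p (k * ‖X j - c‖) : ℂ) * sourcePhase (X j - c) z ^ p) := by
  rw [multipoleCoeff, map_sum, Finset.sum_mul, Finset.sum_mul]
  refine Finset.sum_congr rfl fun j _ => ?_
  rw [map_mul, map_mul, Complex.conj_ofReal, Complex.conj_ofReal, ← Complex.exp_conj, sourcePhase,
    mul_zpow, mul_zpow, ← Complex.exp_int_mul]
  have : conj (-(Complex.I * p * ((X j - c).arg : ℂ))) = p * (Complex.I * ((X j - c).arg : ℂ)) := by
    simp
    ring
  rw [this]
  ring

theorem compressed_eq {N : ℕ} (k : ℝ) (q : Fin N → ℝ) (X : Fin N → ℂ) (c : ℂ) (P : ℕ) (l : ℝ) :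
    compressed k q X c P l = 1 / (4 * (Real.pi : ℂ)) * ∑ j, (q j : ℂ) *
      ∑ p ∈ Finset.Icc (-(P : ℤ)) P,
        (besselJ p (k * ‖X j - c‖) : ℂ) * sourcePhase (X j - c) (spectralZ k l) ^ p := by
  rw [compressed]
  simp_rw [conj_multipoleCoeff_mul]
  rw [Finset.sum_comm]
  simp_rw [Finset.mul_sum]

/-- The source factor as a function of the uniformizing variable `z`. -/
noncomputable def laurentSource {N : ℕ} (k : ℝ) (q : Fin N → ℝ) (X : Fin N → ℂ) (c z : ℂ) : ℂ :=
  1 / (4 * (Real.pi : ℂ)) * ∑ j, (q j : ℂ) * Complex.exp ((k * ‖X j - c‖ : ℝ) / 2 *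
    (sourcePhase (X j - c) z - (sourcePhase (X j - c) z)⁻¹))

theorem differentiableOn_laurentSource {N : ℕ} (k : ℝ) (q : Fin N → ℝ) (X : Fin N → ℂ) (c : ℂ) :
    DifferentiableOn ℂ (laurentSource k q X c) {0}ᶜ := by
  intro z hz
  have hs (d : ℂ) : DifferentiableAt ℂ (sourcePhase d) z := by
    unfold sourcePhase
    fun_prop
  have hsi (d : ℂ) : DifferentiableAt ℂ (fun z => (sourcePhase d z)⁻¹) z :=
    (hs d).inv (sourcePhase_ne_zero d hz)
  have hterm (j : Fin N) := (((((hs (X j - c)).sub (hsi (X j - c))).const_mul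
    (((k * ‖X j - c‖ : ℝ) : ℂ) / 2)).cexp).const_mul (q j : ℂ))
  exact ((DifferentiableAt.fun_sum fun j _ => hterm j).const_mul
    (1 / (4 * (Real.pi : ℂ)))).differentiableWithinAt

theorem uncompressed_eq_laurentSource {N : ℕ} {k : ℝ} (hk : k ≠ 0) (q : Fin N → ℝ)
    (X : Fin N → ℂ) (c : ℂ) (l : ℝ) :
    uncompressed k q X c l = laurentSource k q X c (spectralZ k l) := by
  rw [uncompressed, laurentSource]
  congr 1
  refine Finset.sum_congr rfl fun j _ => ?_
  rw [exp_sourcePhase hk, Complex.sub_im, Complex.sub_re, neg_sub, mul_assoc]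

theorem hasSum_laurentSource {N : ℕ} (k : ℝ) (q : Fin N → ℝ) (X : Fin N → ℂ) (c : ℂ) {z : ℂ}
    (hz : z ≠ 0) :
    HasSum (fun p : ℤ => 1 / (4 * (Real.pi : ℂ)) *
      (conj (multipoleCoeff k q X c p) * (-Complex.I) ^ p) * z ^ p) (laurentSource k q X c z) := by
  simp_rw [mul_assoc (1 / (4 * (Real.pi : ℂ))), conj_multipoleCoeff_mul]
  exact (hasSum_sum fun j _ =>
    (hasSum_besselJ_mul_zpow _ (sourcePhase_ne_zero _ hz)).mul_left _).mul_left _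

theorem tendsto_compressed {N : ℕ} {k : ℝ} (hk : k ≠ 0) (q : Fin N → ℝ) (X : Fin N → ℂ) (c : ℂ)
    (l : ℝ) :
    Tendsto (fun P => compressed k q X c P l) atTop (𝓝 (uncompressed k q X c l)) := by
  rw [uncompressed_eq_laurentSource hk]
  refine ((hasSum_laurentSource k q X c (spectralZ_ne_zero hk l)).comp
    (Finset.tendsto_Icc_neg (R := ℤ))).congr fun P => ?_
  simp only [Function.comp_apply]
  rw [compressed, Finset.mul_sum]
  exact Finset.sum_congr rfl fun p _ => by ring

theorem norm_compressed_le {N : ℕ} {k : ℝ} (hk : 0 < k) (q : Fin N → ℝ) (X : Fin N → ℂ) (c : ℂ)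
    (P : ℕ) (l : ℝ) :
    ‖compressed k q X c P l‖ ≤ 1 / (4 * Real.pi) *
      ∑ j, |q j| * Real.exp (‖X j - c‖ * (k + (spectralRoot k l).re)) := by
  rw [compressed_eq, norm_mul]
  have h0 : ‖1 / (4 * (Real.pi : ℂ))‖ = 1 / (4 * Real.pi) := by
    simp [abs_of_pos Real.pi_pos]
  rw [h0]
  gcongr
  refine (norm_sum_le _ _).trans (Finset.sum_le_sum fun j _ => ?_)
  rw [norm_mul, Complex.norm_real, Real.norm_eq_abs]
  gcongr
  refine (norm_sum_le _ _).trans ((sum_norm_besselJ_mul_zpow_le _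
    (sourcePhase_ne_zero _ (spectralZ_ne_zero hk.ne' l)) _).trans (Real.exp_le_exp.mpr ?_))
  rw [norm_sourcePhase, abs_of_nonneg (by positivity)]
  calc _ = ‖X j - c‖ * (k / 2 * (‖spectralZ k l‖ + ‖spectralZ k l‖⁻¹)) := by ring
    _ ≤ _ := by
      gcongr
      exact norm_spectralZ_add_norm_inv_le hk l

/-- Growth `e^{r Re √(l² - k²)}` amounts to lowering the evaluation point by `r`. The product is
therefore integrable as long as the lowered point stays in the upper half-plane. -/
theorem norm_freeSpaceInfo_mul_exp (k : ℝ) (w : ℂ) (r l : ℝ) :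
    ‖freeSpaceInfo k w l‖ * Real.exp (r * (k + (spectralRoot k l).re)) =
      Real.exp (r * k) * ‖freeSpaceInfo k (w - r * Complex.I) l‖ := by
  have h (w : ℂ) : ‖freeSpaceInfo k w l‖ =
      Real.exp (-((spectralRoot k l).re * w.im)) / ‖spectralRoot k l‖ := by
    rw [freeSpaceInfo, norm_mul, norm_div, Complex.norm_exp, Complex.norm_exp]
    simp
  rw [h, h, mul_add, Real.exp_add]
  have h2 : (w - r * Complex.I).im = w.im - r := by simp
  have h3 : Real.exp (-((spectralRoot k l).re * (w.im - r))) =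
      Real.exp (-((spectralRoot k l).re * w.im)) * Real.exp (r * (spectralRoot k l).re) := by
    rw [← Real.exp_add]
    ring_nf
  rw [h2, h3]
  ring

/-! ### Spectral representations of the scattered field and the limit `P → ∞` -/

theorem sub_imagePoint (x c : ℂ) (s : ℝ) : x - imagePoint c s = x - conj c + s * Complex.I := by
  rw [imagePoint]
  ring

theorem im_sub_conj (x c : ℂ) : (x - conj c).im = x.im + c.im := by simp

theorem hankelWave_sub_imagePoint {k : ℝ} (hk : 0 < k) (n : ℤ) {x c : ℂ} (hx : 0 < x.im)
    (hc : 0 < c.im) {s : ℝ} (hs : 0 ≤ s) :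
    hankelWave k n (x - imagePoint c s) =
      ∫ l, (-Complex.I) ^ n / (Complex.I * (Real.pi : ℂ)) *
        (freeSpaceInfo k (x - conj c) l * spectralZ k l ^ n) *
          Complex.exp (-(spectralRoot k l * s)) := by
  have him : 0 < (x - imagePoint c s).im := by
    rw [sub_imagePoint, Complex.add_im, im_sub_conj]
    simp
    linarith
  rw [hankelWave_eq_integral hk n him, ← integral_const_mul]
  refine integral_congr_ae (Eventually.of_forall fun l => ?_)
  simp only
  rw [sub_imagePoint, freeSpaceInfo_add_mul_I]
  ring

theorem freeGreen_eq_hankelWave (k : ℝ) (x x₀ : ℂ) :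
    freeGreen k x x₀ = Complex.I / 4 * hankelWave k 0 (x - x₀) := by
  simp [freeGreen, hankelWave]

section Reflection

variable {k : ℝ} {α : ℂ} {x : ℂ}

theorem hankelWave_lineImage (hk : 0 < k)
    (hα : 0 < α.im ∨ (α.im = 0 ∧ (0 ≤ α.re ∨ α.re < -k))) (hx : 0 < x.im) {c : ℂ}
    (hc : 0 < c.im) (n : ℤ) :
    (ImproperConverges fun s => hankelWave k n (x - imagePoint c s) * lineImage α s) ∧
      hankelWave k n (x - imagePoint c 0) +
        (improperIntegral fun s => hankelWave k n (x - imagePoint c s) * lineImage α s) =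
      ∫ l, (-Complex.I) ^ n / (Complex.I * (Real.pi : ℂ)) *
        (freeSpaceInfo k (x - conj c) l * spectralZ k l ^ n) * imageInfo k α l :=
  improperIntegral_lineImage hk hα
    ((integrable_freeSpaceInfo_and_integral_eq hk n
      (by rw [im_sub_conj]; linarith)).1.const_mul _)
    (H := fun s => hankelWave k n (x - imagePoint c s))
    fun _ hs => hankelWave_sub_imagePoint hk n hx hc hs

theorem integrable_freeSpaceInfo (hk : 0 < k) {w : ℂ} (hw : 0 < w.im) :
    Integrable (freeSpaceInfo k w) := by
  simpa using (integrable_freeSpaceInfo_and_integral_eq hk 0 hw).1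

theorem freeGreen_lineImage (hk : 0 < k)
    (hα : 0 < α.im ∨ (α.im = 0 ∧ (0 ≤ α.re ∨ α.re < -k))) (hx : 0 < x.im) {x₀ : ℂ}
    (hx₀ : 0 < x₀.im) :
    (ImproperConverges fun s => freeGreen k x (imagePoint x₀ s) * lineImage α s) ∧
      scattered k α x x₀ =
      ∫ l, 1 / (4 * (Real.pi : ℂ)) * freeSpaceInfo k (x - conj x₀) l * imageInfo k α l := by
  have hpi : (Real.pi : ℂ) ≠ 0 := by exact_mod_cast Real.pi_ne_zero
  refine improperIntegral_lineImage hk hα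
    ((integrable_freeSpaceInfo hk (by rw [im_sub_conj]; linarith)).const_mul _)
    (H := fun s => freeGreen k x (imagePoint x₀ s)) fun s hs => ?_
  rw [freeGreen_eq_hankelWave, hankelWave_sub_imagePoint hk 0 hx hx₀ hs, ← integral_const_mul]
  refine integral_congr_ae (Eventually.of_forall fun l => ?_)
  have hI := Complex.I_ne_zero
  simp only [zpow_zero]
  field_simp

variable {N : ℕ} (q : Fin N → ℝ) (X : Fin N → ℂ) (c : ℂ)

theorem freeSpaceInfo_mul_compressed (P : ℕ) (l : ℝ) :
    freeSpaceInfo k (x - conj c) l * compressed k q X c P l * imageInfo k α l =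
      ∑ p ∈ Finset.Icc (-(P : ℤ)) P, Complex.I / 4 * conj (multipoleCoeff k q X c p) *
        ((-Complex.I) ^ p / (Complex.I * (Real.pi : ℂ)) *
          (freeSpaceInfo k (x - conj c) l * spectralZ k l ^ p) * imageInfo k α l) := by
  have hpi : (Real.pi : ℂ) ≠ 0 := by exact_mod_cast Real.pi_ne_zero
  have hI := Complex.I_ne_zero
  rw [compressed, Finset.mul_sum, Finset.mul_sum, Finset.sum_mul]
  refine Finset.sum_congr rfl fun p _ => ?_
  field_simp

theorem imageExpansion_eq_integral (hk : 0 < k)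
    (hα : 0 < α.im ∨ (α.im = 0 ∧ (0 ≤ α.re ∨ α.re < -k))) (hx : 0 < x.im) (hc : 0 < c.im)
    (P : ℕ) :
    Integrable (fun l : ℝ => freeSpaceInfo k (x - conj c) l * compressed k q X c P l *
        imageInfo k α l) ∧
      imageExpansion k α q X c P x =
        ∫ l : ℝ, freeSpaceInfo k (x - conj c) l * compressed k q X c P l * imageInfo k α l := by
  have hint (p : ℤ) : Integrable fun l => Complex.I / 4 * conj (multipoleCoeff k q X c p) *
        ((-Complex.I) ^ p / (Complex.I * (Real.pi : ℂ)) *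
          (freeSpaceInfo k (x - conj c) l * spectralZ k l ^ p) * imageInfo k α l) :=
    (integrable_mul_imageInfo hk hα ((integrable_freeSpaceInfo_and_integral_eq hk p
      (by rw [im_sub_conj]; linarith)).1.const_mul _)).const_mul _
  simp_rw [freeSpaceInfo_mul_compressed]
  refine ⟨integrable_finsetSum _ fun p _ => hint p, ?_⟩
  rw [integral_finsetSum _ fun p _ => hint p, imageExpansion, Finset.mul_sum]
  refine Finset.sum_congr rfl fun p _ => ?_
  rw [(hankelWave_lineImage hk hα hx hc p).2, integral_const_mul, mul_assoc]

/-- Each summand of the source factor translates the base point from the image of `c` to the image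
of `X j`, so the sources decouple. -/
theorem freeSpaceInfo_mul_uncompressed (l : ℝ) :
    freeSpaceInfo k (x - conj c) l * uncompressed k q X c l * imageInfo k α l =
      ∑ j, (q j : ℂ) *
        (1 / (4 * (Real.pi : ℂ)) * freeSpaceInfo k (x - conj (X j)) l * imageInfo k α l) := by
  rw [uncompressed, Finset.mul_sum, Finset.mul_sum, Finset.sum_mul]
  refine Finset.sum_congr rfl fun j _ => ?_
  have h : freeSpaceInfo k (x - conj (X j)) l = freeSpaceInfo k (x - conj c) l *
      (Complex.exp (-(spectralRoot k l * (((X j).im - c.im : ℝ) : ℂ))) *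
        Complex.exp (Complex.I * (l : ℂ) * ((c.re - (X j).re : ℝ) : ℂ))) := by
    have h1 : Complex.exp (-(spectralRoot k l * ((x - conj (X j)).im : ℂ))) =
        Complex.exp (-(spectralRoot k l * ((x - conj c).im : ℂ))) *
          Complex.exp (-(spectralRoot k l * (((X j).im - c.im : ℝ) : ℂ))) := by
      rw [← Complex.exp_add, im_sub_conj, im_sub_conj]
      congr 1
      push_cast
      ring
    have h2 : Complex.exp (Complex.I * (l : ℂ) * ((x - conj (X j)).re : ℂ)) =
        Complex.exp (Complex.I * (l : ℂ) * ((x - conj c).re : ℂ)) *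
          Complex.exp (Complex.I * (l : ℂ) * ((c.re - (X j).re : ℝ) : ℂ)) := by
      rw [← Complex.exp_add]
      congr 1
      simp only [Complex.sub_re, Complex.conj_re]
      push_cast
      ring
    rw [freeSpaceInfo, freeSpaceInfo, h1, h2]
    ring
  rw [h]
  ring

theorem scatteredField_eq_integral (hk : 0 < k)
    (hα : 0 < α.im ∨ (α.im = 0 ∧ (0 ≤ α.re ∨ α.re < -k))) (hx : 0 < x.im)
    (hX : ∀ j, 0 < (X j).im) :
    Integrable (fun l : ℝ => freeSpaceInfo k (x - conj c) l * uncompressed k q X c l *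
        imageInfo k α l) ∧
      scatteredField k α q X x =
        ∫ l : ℝ, freeSpaceInfo k (x - conj c) l * uncompressed k q X c l * imageInfo k α l := by
  have hint (j : Fin N) : Integrable fun l => (q j : ℂ) *
      (1 / (4 * (Real.pi : ℂ)) * freeSpaceInfo k (x - conj (X j)) l * imageInfo k α l) :=
    (integrable_mul_imageInfo hk hα ((integrable_freeSpaceInfo hk
      (by rw [im_sub_conj]; linarith [hX j])).const_mul _)).const_mul _
  simp_rw [freeSpaceInfo_mul_uncompressed]
  refine ⟨integrable_finsetSum _ fun j _ => hint j, ?_⟩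
  rw [integral_finsetSum _ fun j _ => hint j, scatteredField]
  refine Finset.sum_congr rfl fun j _ => ?_
  rw [(freeGreen_lineImage hk hα hx (hX j)).2, integral_const_mul]

theorem tendsto_integral_compressed (hk : 0 < k)
    (hα : 0 < α.im ∨ (α.im = 0 ∧ (0 ≤ α.re ∨ α.re < -k))) (hx : 0 < x.im) (hc : 0 < c.im)
    (hX : ∀ j, ‖X j - c‖ < x.im + c.im) :
    Tendsto (fun P : ℕ => ∫ l : ℝ,
        freeSpaceInfo k (x - conj c) l * compressed k q X c P l * imageInfo k α l) atTop
      (𝓝 (∫ l : ℝ,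
        freeSpaceInfo k (x - conj c) l * uncompressed k q X c l * imageInfo k α l)) := by
  obtain ⟨M, hM⟩ := exists_norm_imageInfo_le hk hα
  refine tendsto_integral_of_dominated_convergence
    -- The majorant is a sum of free-space factors at the target lowered by `‖X j - c‖`; its
    -- integrability is where the distance condition is used.
    (fun l => 1 / (4 * Real.pi) * (∑ j, |q j| * (Real.exp (‖X j - c‖ * k) *
      ‖freeSpaceInfo k (x - conj c - ‖X j - c‖ * Complex.I) l‖)) * M)
    (fun P => (imageExpansion_eq_integral q X c hk hα hx hc P).1.aestronglyMeasurable)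
    (((integrable_finsetSum _ fun j _ => ((integrable_freeSpaceInfo hk ?_).norm.const_mul
      _).const_mul _).const_mul _).mul_const _)
    (fun P => Eventually.of_forall fun l => ?_)
    (Eventually.of_forall fun l =>
      ((tendsto_compressed hk.ne' q X c l).const_mul _).mul_const _)
  · rw [Complex.sub_im, im_sub_conj]
    simpa using hX j
  · rw [norm_mul, norm_mul]
    calc _ ≤ ‖freeSpaceInfo k (x - conj c) l‖ * (1 / (4 * Real.pi) *
          ∑ j, |q j| * Real.exp (‖X j - c‖ * (k + (spectralRoot k l).re))) * M := by
          gcongr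
          · exact norm_compressed_le hk q X c P l
          · exact hM l
      _ = _ := by
          congr 1
          rw [mul_left_comm, Finset.mul_sum]
          congr 1
          refine Finset.sum_congr rfl fun j _ => ?_
          rw [← norm_freeSpaceInfo_mul_exp]
          ring

end Reflection

end HalfSpace

theorem mainTheorem2 (k : ℝ) (hk : 0 < k) (α : ℂ)
    (hα : 0 < α.im ∨ (α.im = 0 ∧ (0 ≤ α.re ∨ α.re < -k)))
    (N : ℕ) (q : Fin N → ℝ) (X : Fin N → ℂ) (hX : ∀ j, 0 < (X j).im)
    (c : ℂ) (hc : 0 < c.im) (x : ℂ) (hx : 0 < x.im) :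
    -- Sommerfeld representation of `H_n(kρ) e^{inθ}`
    (∀ (n : ℤ) (w : ℂ), 0 < w.im →
      Integrable (fun l : ℝ => HalfSpace.freeSpaceInfo k w l * HalfSpace.spectralZ k l ^ n) ∧
      HalfSpace.hankelWave k n w = (-Complex.I) ^ n / (Complex.I * (Real.pi : ℂ)) *
        ∫ l : ℝ, HalfSpace.freeSpaceInfo k w l * HalfSpace.spectralZ k l ^ n) ∧
    -- compressed representation: the truncated image expansion as one spectral integral
    (∀ p : ℤ, HalfSpace.ImproperConverges fun s =>
      HalfSpace.hankelWave k p (x - HalfSpace.imagePoint c s) * HalfSpace.lineImage α s) ∧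
    (∀ P : ℕ,
      Integrable (fun l : ℝ => HalfSpace.freeSpaceInfo k (x - conj c) l *
        HalfSpace.compressed k q X c P l * HalfSpace.imageInfo k α l) ∧
      HalfSpace.imageExpansion k α q X c P x =
        ∫ l : ℝ, HalfSpace.freeSpaceInfo k (x - conj c) l *
          HalfSpace.compressed k q X c P l * HalfSpace.imageInfo k α l) ∧
    -- uncompressed representation of the scattered field
    (∀ j, HalfSpace.ImproperConverges fun s =>
      HalfSpace.freeGreen k x (HalfSpace.imagePoint (X j) s) * HalfSpace.lineImage α s) ∧
    Integrable (fun l : ℝ => HalfSpace.freeSpaceInfo k (x - conj c) l *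
      HalfSpace.uncompressed k q X c l * HalfSpace.imageInfo k α l) ∧
    HalfSpace.scatteredField k α q X x =
      ∫ l : ℝ, HalfSpace.freeSpaceInfo k (x - conj c) l *
        HalfSpace.uncompressed k q X c l * HalfSpace.imageInfo k α l ∧
    -- the uncompressed factor is a holomorphic function of `z` on the punctured plane; the
    -- compressed factor is its truncated Laurent expansion
    (∃ (F : ℂ → ℂ) (a : ℤ → ℂ), DifferentiableOn ℂ F {0}ᶜ ∧
      (∀ l : ℝ, HalfSpace.spectralZ k l ≠ 0 ∧
        HalfSpace.uncompressed k q X c l = F (HalfSpace.spectralZ k l)) ∧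
      (∀ p : ℤ, a p = 1 / (4 * (Real.pi : ℂ)) *
        (conj (HalfSpace.multipoleCoeff k q X c p) * (-Complex.I) ^ p)) ∧
      (∀ z : ℂ, z ≠ 0 → HasSum (fun p : ℤ => a p * z ^ p) (F z)) ∧
      (∀ (P : ℕ) (l : ℝ), HalfSpace.compressed k q X c P l =
        ∑ p ∈ Finset.Icc (-(P : ℤ)) P, a p * HalfSpace.spectralZ k l ^ p)) ∧
    -- the compressed representation approximates the scattered field as `P → ∞`
    ((∀ j, ‖X j - c‖ < x.im + c.im) →
      Tendsto (fun P : ℕ => ∫ l : ℝ, HalfSpace.freeSpaceInfo k (x - conj c) l *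
          HalfSpace.compressed k q X c P l * HalfSpace.imageInfo k α l)
        atTop (𝓝 (HalfSpace.scatteredField k α q X x))) := by
  refine ⟨fun n w hw => ⟨(HalfSpace.integrable_freeSpaceInfo_and_integral_eq hk n hw).1,
      HalfSpace.hankelWave_eq_integral hk n hw⟩,
    fun p => (HalfSpace.hankelWave_lineImage hk hα hx hc p).1,
    fun P => HalfSpace.imageExpansion_eq_integral q X c hk hα hx hc P,
    fun j => (HalfSpace.freeGreen_lineImage hk hα hx (hX j)).1,
    (HalfSpace.scatteredField_eq_integral q X c hk hα hx hX).1,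
    (HalfSpace.scatteredField_eq_integral q X c hk hα hx hX).2,
    ⟨HalfSpace.laurentSource k q X c, _, HalfSpace.differentiableOn_laurentSource k q X c,
      fun l => ⟨HalfSpace.spectralZ_ne_zero hk.ne' l,
        HalfSpace.uncompressed_eq_laurentSource hk.ne' q X c l⟩,
      fun p => rfl, fun z hz => HalfSpace.hasSum_laurentSource k q X c hz, fun P l => ?_⟩,
    fun h => ?_⟩
  · rw [HalfSpace.compressed, Finset.mul_sum]
    exact Finset.sum_congr rfl fun p _ => by ring
  · rw [(HalfSpace.scatteredField_eq_integral q X c hk hα hx hX).2]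
    exact HalfSpace.tendsto_integral_compressed q X c hk hα hx hc h
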